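/- **Setting.** Let $(x,B):\mathbb Z^3\to\mathbb R^3\times\{\text{orthonormal frames }B=(t^{(1)},t^{(2)},t^{(3)})\}$ be a 3D cyclidic net. Write $x_i(z)=x(z+\mathbf e_i)$, and so on. Being a cyclidic net means the following. For all $z$ and $i<j$ the points $x,x_i,x_{ij},x_j$ lie on a circle (or straight line), are distinct, and follow each other in this cyclic order, i.e. the quadrilateral $(x,x_i,x_{ij},x_j)$ is embedded. Moreover $B_i=H^{(i)}(F^{(i)}(B))$ for each $i$, where $F^{(i)}$ replaces $t^{(i)}$ by $-t^{(i)}$ and $H^{(i)}(v)=v-2\frac{\langle x_i-x,v\rangle}{\langle x_i-x,x_i-x\rangle}(x_i-x)$ is applied to each vector of the frame. **Cyclidic patches.** A Dupin cyclide is the envelope in $\mathbb R^3\cup\{\infty\}$ of two polar families of oriented spheres, given by an orthogonal decomposition $\mathbb R^{4,2}=P\oplus P'$ of the Lie-geometric coordinate space into 3-dimensional subspaces of signature $(++-)$. Its contact elements are the isotropic lines spanned by one sphere of each family, and its singular points are the point spheres (spheres of radius $0$) in the two families. A non-singular cyclidic patch is either * the restriction of the curvature line parametrization of a Dupin cyclide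 (the two parameters run through the two conics of spheres) to a closed rectangle, containing no singular points of the cyclide; or * a spherical patch (the degenerate case): a piece of an oriented sphere or plane which is the image under a Möbius transformation of a closed rectangle in Cartesian coordinates, or in polar coordinates (radii positive, angular length less than $2\pi$), of the plane. Every point of a patch carries the unit normal of its contact element (at $\infty$: the common normal of the corresponding parallel planes). If the patch $f:[0,1]^2\to\mathbb R^3\cup\{\infty\}$ has $f(0,0)\in\mathbb R^3$, its vertex frame at $f(0,0)$ consists of the unit tangent vectors there of the boundary arcs $f(\cdot,0)$ and $f(0,\cdot)$, directed into the arcs, and the normal. **Cyclidic cube.** Fix $z\in\mathbb Z^3$. The cyclidic cube at $z$ has six faces. For $\{i,j,k\}=\{1,2,3\}$ in cyclic order and $\varepsilon\in\{0,1\}$, the face $f^{(i),\varepsilon}$ is the cyclidic patch with vertices $(x,x_j,x_{jk},x_k)$ and vertex frame $(t^{(j)},t^{(k)},t^{(i)})$ at $x$, all taken at the lattice point $z+\varepsilon\mathbf e_i$. Assume that all six faces are non-singular patches. **Proposition.** Let $i\neq j$, let $k$ be the third index, and let $\varepsilon,\delta\in\{0,1\}$. Then the boundary arcs of the adjacent faces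 $f^{(i),\varepsilon}$ and $f^{(j),\delta}$ over their common edge, from $x(z+\varepsilon\mathbf e_i+\delta\mathbf e_j)$ to $x(z+\varepsilon\mathbf e_i+\delta\mathbf e_j+\mathbf e_k)$, are the same set of points of $\mathbb R^3\cup\{\infty\}$, and at every point of this arc the normals of the two faces are orthogonal. That is, adjacent faces of a cyclidic cube intersect orthogonally along their whole common boundary arc, not only at the vertices. -/

import Mathlib

open Set Filter Topology

noncomputable section

/-! ## Circular nets and cyclidic nets in Euclidean space -/

/-- The unit vector of the `i`-th coordinate direction of the lattice `ℤ^m`. -/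
def unitShift {m : ℕ} (i : Fin m) : Fin m → ℤ := Pi.single i 1

/-- Four points of `ℝ^N` lie on a generalized circle: a proper circle, or a straight line
(a circle through `∞`). -/
def OnGeneralizedCircle {N : ℕ} (a b c d : EuclideanSpace ℝ (Fin N)) : Prop :=
  EuclideanGeometry.Concyclic ({a, b, c, d} : Set (EuclideanSpace ℝ (Fin N))) ∨
    Collinear ℝ ({a, b, c, d} : Set (EuclideanSpace ℝ (Fin N)))

/-- The quadrilateral `(a, b, c, d)` with vertices on a generalized circle is embedded: its
vertices are distinct and follow each other in this cyclic order on the circle.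
On a proper circle this says that non-adjacent edges are disjoint, on a straight
line (closed up by `∞`) that exactly one of `b`, `d` lies between `a` and `c`. -/
def IsEmbeddedQuad {N : ℕ} (a b c d : EuclideanSpace ℝ (Fin N)) : Prop :=
  (a ≠ b ∧ a ≠ c ∧ a ≠ d ∧ b ≠ c ∧ b ≠ d ∧ c ≠ d) ∧
    ((EuclideanGeometry.Concyclic ({a, b, c, d} : Set (EuclideanSpace ℝ (Fin N))) ∧
        Disjoint (segment ℝ a b) (segment ℝ c d) ∧ Disjoint (segment ℝ b c) (segment ℝ d a)) ∨
      (Collinear ℝ ({a, b, c, d} : Set (EuclideanSpace ℝ (Fin N))) ∧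
        Xor (Sbtw ℝ a b c) (Sbtw ℝ a d c)))

/-- A circular net: all elementary quadrilaterals `(x, x_i, x_ij, x_j)` are circular. -/
def IsCircularNet {m N : ℕ} (x : (Fin m → ℤ) → EuclideanSpace ℝ (Fin N)) : Prop :=
  ∀ (z : Fin m → ℤ) (i j : Fin m), i < j →
    OnGeneralizedCircle (x z) (x (z + unitShift i)) (x (z + unitShift i + unitShift j))
      (x (z + unitShift j))

/-- The action on vectors of the reflection in the perpendicular bisecting hyperplane of the
segment `[p, q]`. -/
def bisectorReflection {N : ℕ} (p q v : EuclideanSpace ℝ (Fin N)) : EuclideanSpace ℝ (Fin N) :=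
  v - (2 * (inner ℝ (q - p) v / inner ℝ (q - p) (q - p))) • (q - p)

/-- An `m`-dimensional cyclidic net `(x, B)` in `ℝ^N`, `B z = (t z 0, …, t z (m-1))`. -/
structure IsCyclidicNet {m N : ℕ} (x : (Fin m → ℤ) → EuclideanSpace ℝ (Fin N))
    (t : (Fin m → ℤ) → Fin m → EuclideanSpace ℝ (Fin N)) : Prop where
  circular : IsCircularNet x
  embedded : ∀ (z : Fin m → ℤ) (i j : Fin m), i < j →
    IsEmbeddedQuad (x z) (x (z + unitShift i)) (x (z + unitShift i + unitShift j))
      (x (z + unitShift j))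
  orthonormal : ∀ z, Orthonormal ℝ (t z)
  /-- `B_i = H^(i) (F^(i) (B))`, where `F^(i)` reverses the `i`-th vector of the frame. -/
  evolution : ∀ (z : Fin m → ℤ) (i j : Fin m),
    t (z + unitShift i) j =
      bisectorReflection (x z) (x (z + unitShift i)) (if j = i then -t z j else t z j)

/-! ## Lie geometry of oriented spheres in `ℝ³ ∪ {∞}` -/

/-- Euclidean 3-space. -/
abbrev E3 : Type := EuclideanSpace ℝ (Fin 3)

/-- The space `ℝ^{4,2}` of homogeneous coordinates; `(c, a₀, a_∞, a_r)` stands for the vector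
`c + a₀ e₀ + a_∞ e_∞ + a_r e_r`. -/
abbrev LieSpace : Type := E3 × ℝ × ℝ × ℝ

/-- The `e_r`-component; for an isotropic vector it vanishes exactly for point spheres. -/
def rComp (v : LieSpace) : ℝ := v.2.2.2

/-- The product of signature `(4,2)`: `e₀`, `e_∞` are isotropic with `⟨e₀, e_∞⟩ = -1/2`, and
`⟨e_r, e_r⟩ = -1`. -/
def lieForm (v w : LieSpace) : ℝ :=
  inner ℝ v.1 w.1 - (v.2.1 * w.2.2.1 + v.2.2.1 * w.2.1) / 2 - rComp v * rComp w

/-- Homogeneous coordinates of a point of `ℝ³ ∪ {∞}`, seen as a sphere of radius zero. -/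
def pointCoord : OnePoint E3 → LieSpace
  | none => (0, 0, 1, 0)
  | some p => (p, 1, ‖p‖ ^ 2, 0)

/-- Homogeneous coordinates of the oriented plane with unit normal `n` and offset `d`. -/
def planeCoord (n : E3) (d : ℝ) : LieSpace := (n, 0, 2 * d, 1)

/-- A contact element: a point of `ℝ³ ∪ {∞}` with a unit normal. At `∞` the normal is the common
normal of a pencil of parallel oriented planes. -/
structure ContactElement where
  point : OnePoint E3
  normal : E3
  norm_normal : ‖normal‖ = 1

/-- The isotropic line (a two-dimensional linear subspace of `ℝ^{4,2}`) of a contact element. It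
consists of the oriented spheres through the point with the given normal there, and is spanned by
the point and by the plane through it. -/
def ContactElement.line (e : ContactElement) : Submodule ℝ LieSpace :=
  Submodule.span ℝ {pointCoord e.point,
    planeCoord e.normal
      (match e.point with
        | none => 0
        | some p => inner ℝ p e.normal)}

/-- Two contact elements at the same point are orthogonal, i.e. so are their tangent planes. -/
def ContactElement.IsOrthogonal (e e' : ContactElement) : Prop :=
  e.point = e'.point ∧ inner ℝ e.normal e'.normal = 0

/-! ## Dupin cyclides and cyclidic patches -/

/-- A projective plane of signature `(++-)` in the projective space over `ℝ^{4,2}`. -/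
def IsCyclidicPlane (P : Submodule ℝ LieSpace) : Prop :=
  ∃ a b c : LieSpace, P = Submodule.span ℝ {a, b, c} ∧
    lieForm a a = 1 ∧ lieForm b b = 1 ∧ lieForm c c = -1 ∧
    lieForm a b = 0 ∧ lieForm a c = 0 ∧ lieForm b c = 0

/-- A Dupin cyclide: a polar decomposition of `ℝ^{4,2}` into planes of signature `(++-)`. The
enveloping spheres are the isotropic vectors of `P` and of `P'`. -/
structure IsDupinCyclide (P P' : Submodule ℝ LieSpace) : Prop where
  left : IsCyclidicPlane P
  right : IsCyclidicPlane P'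
  polar : ∀ w : LieSpace, w ∈ P' ↔ ∀ v ∈ P, lieForm v w = 0

/-- Singular points of a cyclide: the point spheres in one of its two families of spheres. -/
def IsSingularPoint (P P' : Submodule ℝ LieSpace) (p : OnePoint E3) : Prop :=
  pointCoord p ∈ P ∨ pointCoord p ∈ P'

/-- Three distinct spheres of the family `P ∩ {isotropic vectors}` (three points of the
corresponding non-degenerate conic). -/
structure IsSphereTriple (P : Submodule ℝ LieSpace) (s : Fin 3 → LieSpace) : Prop where
  mem : ∀ k, s k ∈ P
  isotropic : ∀ k, lieForm (s k) (s k) = 0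
  linearIndependent : LinearIndependent ℝ s

/-- The quadratic parametrization of the conic through `s 0`, `s 1`, `s 2` which takes, up to
nonzero factors, the values `s 0`, `s 1`, `s 2` at `0`, `1/2`, `1`. -/
def conicParam (s : Fin 3 → LieSpace) (w : ℝ) : LieSpace :=
  (lieForm (s 1) (s 2) * (2 * w ^ 2 - 3 * w + 1)) • s 0 +
    (lieForm (s 0) (s 2) * (w - w ^ 2)) • s 1 +
    (lieForm (s 0) (s 1) * (2 * w ^ 2 - w)) • s 2

/-- A parametrized family of contact elements. For patches only its values on the square
`[0,1] × [0,1]` matter. -/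
abbrev PatchMap : Type := ℝ → ℝ → ContactElement

/-- A non-singular patch cut out of a Dupin cyclide along curvature lines: the contact element at
`(u, v)` is the line through the enveloping spheres `s (u)` and `s' (v)`. As the three spheres in
each triple are arbitrary, every closed parameter rectangle is covered. -/
def IsNonsingularDupinPatch (f : PatchMap) : Prop :=
  ∃ (P P' : Submodule ℝ LieSpace) (s s' : Fin 3 → LieSpace),
    IsDupinCyclide P P' ∧ IsSphereTriple P s ∧ IsSphereTriple P' s' ∧
    ∀ u ∈ Icc (0 : ℝ) 1, ∀ v ∈ Icc (0 : ℝ) 1,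
      (f u v).line = Submodule.span ℝ {conicParam s u, conicParam s' v} ∧
      ¬ IsSingularPoint P P' (f u v).point

/-- A rectangle in Cartesian coordinates of the plane. -/
def IsCartesianRectangle (y : ℝ → ℝ → ℝ × ℝ) : Prop :=
  ∃ a₀ a₁ b₀ b₁ : ℝ, a₀ ≠ a₁ ∧ b₀ ≠ b₁ ∧
    ∀ u v, y u v = ((1 - u) * a₀ + u * a₁, (1 - v) * b₀ + v * b₁)

/-- A rectangle in polar coordinates of the plane, with the radius as first parameter. -/
def IsPolarRectangle (y : ℝ → ℝ → ℝ × ℝ) : Prop :=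
  ∃ r₀ r₁ θ₀ θ₁ : ℝ, 0 < r₀ ∧ 0 < r₁ ∧ r₀ ≠ r₁ ∧ θ₀ ≠ θ₁ ∧ |θ₁ - θ₀| < 2 * Real.pi ∧
    ∀ u v, y u v =
      (((1 - u) * r₀ + u * r₁) * Real.cos ((1 - v) * θ₀ + v * θ₁),
        ((1 - u) * r₀ + u * r₁) * Real.sin ((1 - v) * θ₀ + v * θ₁))

/-- Four vectors of `ℝ^{4,2}` without `e_r`-component, with the same products as
`e₀, e_∞, e₁, e₂`. They give the Möbius transformation of the plane onto a sphere or plane which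
sends `(y₁, y₂)` to the point `q₀ + y₁ a + y₂ b + (y₁² + y₂²) q`. -/
structure IsMoebiusFrame (q₀ q a b : LieSpace) : Prop where
  rComp_eq : rComp q₀ = 0 ∧ rComp q = 0 ∧ rComp a = 0 ∧ rComp b = 0
  isotropic : lieForm q₀ q₀ = 0 ∧ lieForm q q = 0 ∧ lieForm q₀ q = -(1 / 2)
  unit : lieForm a a = 1 ∧ lieForm b b = 1 ∧ lieForm a b = 0
  orthogonal : lieForm q₀ a = 0 ∧ lieForm q₀ b = 0 ∧ lieForm q a = 0 ∧ lieForm q b = 0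

/-- A non-singular spherical patch: a piece of an oriented sphere or plane `S` cut out along two
orthogonal families (pencils) of circles. Up to Möbius transformations there are two such pairs
of families: the coordinate lines of Cartesian and of polar coordinates of the plane. The two
parameters may be exchanged. -/
def IsNonsingularSphericalPatch (f : PatchMap) : Prop :=
  ∃ (S q₀ q a b : LieSpace) (y : ℝ → ℝ → ℝ × ℝ),
    lieForm S S = 0 ∧ rComp S ≠ 0 ∧ IsMoebiusFrame q₀ q a b ∧
    lieForm S q₀ = 0 ∧ lieForm S q = 0 ∧ lieForm S a = 0 ∧ lieForm S b = 0 ∧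
    (IsCartesianRectangle y ∨ IsPolarRectangle y ∨ IsPolarRectangle (fun u v => y v u)) ∧
    ∀ u ∈ Icc (0 : ℝ) 1, ∀ v ∈ Icc (0 : ℝ) 1,
      (f u v).line = Submodule.span ℝ
        {q₀ + (y u v).1 • a + (y u v).2 • b + ((y u v).1 ^ 2 + (y u v).2 ^ 2) • q, S}

/-- A non-singular cyclidic patch, spherical patches included as degenerate case. -/
def IsNonsingularCyclidicPatch (f : PatchMap) : Prop :=
  IsNonsingularDupinPatch f ∨ IsNonsingularSphericalPatch f

/-- The unit vector `τ` is the tangent direction at the initial point of the curve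
`γ : [0,1] → ℝ³ ∪ {∞}`, directed into the curve. -/
def HasInitialTangent (γ : ℝ → OnePoint E3) (τ : E3) : Prop :=
  ∃ (g : ℝ → E3) (c : ℝ), 0 < c ∧ (∀ᶠ w in 𝓝[≥] (0 : ℝ), γ w = (g w : OnePoint E3)) ∧
    HasDerivWithinAt g (c • τ) (Ici 0) 0

/-- The patch `f` has vertices `(x, x₁, x₁₂, x₂)` and vertex frame `(τ₁, τ₂, n)` at `x`. -/
structure HasVerticesAndFrame (f : PatchMap) (x x₁ x₁₂ x₂ τ₁ τ₂ n : E3) : Prop where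
  vertex : (f 0 0).point = (x : OnePoint E3)
  vertex₁ : (f 1 0).point = (x₁ : OnePoint E3)
  vertex₁₂ : (f 1 1).point = (x₁₂ : OnePoint E3)
  vertex₂ : (f 0 1).point = (x₂ : OnePoint E3)
  tangent₁ : HasInitialTangent (fun u => (f u 0).point) τ₁
  tangent₂ : HasInitialTangent (fun v => (f 0 v).point) τ₂
  normal : (f 0 0).normal = n

/-! ## Cyclidic cubes -/

/-- The patches `f i ε` are the six faces of the elementary hexahedron at `z` of the cyclidic net
`(x, t)`. The face `f i ε` belongs to the quadrilateral with base vertex `w = z + ε e_i` spanned by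
the directions `j = i + 1` and `k = i + 2` (modulo 3): its vertices are `(x, x_j, x_jk, x_k)` at `w`
and it is determined by the frame of the net at `w`, with `t^(i)` as normal. -/
def AreCubeFaces (x : (Fin 3 → ℤ) → E3) (t : (Fin 3 → ℤ) → Fin 3 → E3) (z : Fin 3 → ℤ)
    (f : Fin 3 → Fin 2 → PatchMap) : Prop :=
  ∀ (i : Fin 3) (ε : Fin 2),
    let w : Fin 3 → ℤ := z + ((ε : ℕ) : ℤ) • unitShift i
    IsNonsingularCyclidicPatch (f i ε) ∧
      HasVerticesAndFrame (f i ε) (x w) (x (w + unitShift (i + 1)))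
        (x (w + unitShift (i + 1) + unitShift (i + 2))) (x (w + unitShift (i + 2)))
        (t w (i + 1)) (t w (i + 2)) (t w i)

/-- The boundary curve of a face normal to direction `i` along which the cube coordinate in
direction `j ≠ i` is fixed to `δ`; it is parametrized by `[0,1]` and carries the contact elements
of the face. -/
def faceEdge (f : PatchMap) (i j : Fin 3) (δ : Fin 2) : ℝ → ContactElement :=
  if j = i + 1 then fun w => f ((δ : ℕ) : ℝ) w else fun w => f w ((δ : ℕ) : ℝ)

/-- The set of points of a boundary curve. -/
def edgeArc (γ : ℝ → ContactElement) : Set (OnePoint E3) :=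
  (fun w => (γ w).point) '' Icc 0 1

end

noncomputable section

/-! ## The form, point spheres and contact elements -/

/-! Along a boundary arc of a patch all contact elements share one sphere `S` that is not a point: a
sphere of one family of the cyclide, or the carrier sphere of a spherical patch. If two contact
elements have the same point, the product of spheres `S`, `S'` in them, divided by `rComp S * rComp
S'`, is the cosine of the angle between the normals minus one
(`ContactElement.lieForm_of_mem_line`). Hence two faces along a common arc have the same angle at
every common point, and it suffices to know it at the initial vertex, where the normals are two
vectors of the orthonormal frame of the net.

It remains to identify arcs and initial normals. A boundary arc is a conic of point spheres with
control vectors `A`, `M`, `C`, and it is determined by its end points and its initial tangent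
(`IsBlendArc.exists_tangent`, `IsBlendArc.edgeArc_eq`). The vertex frame prescribes the tangent at
the base vertex only, so the opposite edge needs an argument. The control vectors of opposite edges
differ by multiples of a single vector `m`. This forces their initial tangents to be mirror images
in the bisecting plane of the initial points, up to a positive or negative factor
(`tangent_eq_bisectorReflection`). A negative factor would make two opposite sides of the vertex
quadrilateral separate each other, which embeddedness forbids (`IsEmbeddedQuad.not_crossing`). The
normals are mirror images because the two initial contact elements share a sphere. So a patch
carries its frame across an edge by the rule of the net (`IsBlendPair.isFrameArc`), and both faces
at a cube edge see the frame of the net at its initial vertex.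

The vector `m` is found case by case: for Dupin patches and for Cartesian, radial and angular edges
of spherical patches. -/

theorem lieForm_add_left (u v w : LieSpace) : lieForm (u + v) w = lieForm u w + lieForm v w := by
  simp only [lieForm, rComp, Prod.fst_add, Prod.snd_add, inner_add_left]; ring

theorem lieForm_smul_left (c : ℝ) (v w : LieSpace) : lieForm (c • v) w = c * lieForm v w := by
  simp only [lieForm, rComp, Prod.smul_fst, Prod.smul_snd, real_inner_smul_left, smul_eq_mul]; ring

theorem lieForm_comm (v w : LieSpace) : lieForm v w = lieForm w v := by
  simp only [lieForm, real_inner_comm]; ring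

theorem lieForm_add_right (u v w : LieSpace) : lieForm u (v + w) = lieForm u v + lieForm u w := by
  rw [lieForm_comm, lieForm_add_left, lieForm_comm v, lieForm_comm w]

theorem lieForm_smul_right (c : ℝ) (v w : LieSpace) : lieForm v (c • w) = c * lieForm v w := by
  rw [lieForm_comm, lieForm_smul_left, lieForm_comm w]

theorem lieForm_sub_left (u v w : LieSpace) : lieForm (u - v) w = lieForm u w - lieForm v w := by
  simp only [lieForm, rComp, Prod.fst_sub, Prod.snd_sub, inner_sub_left]; ring

theorem lieForm_sub_right (u v w : LieSpace) : lieForm u (v - w) = lieForm u v - lieForm u w := by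
  rw [lieForm_comm, lieForm_sub_left, lieForm_comm v, lieForm_comm w]

theorem rComp_add (v w : LieSpace) : rComp (v + w) = rComp v + rComp w := rfl

theorem rComp_sub (v w : LieSpace) : rComp (v - w) = rComp v - rComp w := rfl

theorem rComp_smul (c : ℝ) (v : LieSpace) : rComp (c • v) = c * rComp v := rfl

theorem pointCoord_coe (p : E3) : pointCoord (p : OnePoint E3) = (p, 1, ‖p‖ ^ 2, 0) := rfl

theorem pointCoord_infty : pointCoord (OnePoint.infty : OnePoint E3) = (0, 0, 1, 0) := rfl

theorem rComp_pointCoord (p : OnePoint E3) : rComp (pointCoord p) = 0 := by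
  cases p <;> rfl

theorem pointCoord_ne_zero (p : OnePoint E3) : pointCoord p ≠ 0 := by
  induction p using OnePoint.rec with
  | infty => simp [pointCoord_infty]
  | coe p => simp [pointCoord_coe]

theorem lieForm_pointCoord_self (p : OnePoint E3) : lieForm (pointCoord p) (pointCoord p) = 0 := by
  induction p using OnePoint.rec with
  | infty => simp [pointCoord_infty, lieForm, rComp]
  | coe p => simp [pointCoord_coe, lieForm, rComp]

theorem lieForm_pointCoord_coe (p q : E3) :
    lieForm (pointCoord (p : OnePoint E3)) (pointCoord (q : OnePoint E3)) = -‖p - q‖ ^ 2 / 2 := by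
  rw [@norm_sub_sq_real]
  simp [pointCoord_coe, lieForm, rComp]
  ring

/-- Points of `ℝ³ ∪ {∞}` are determined by their homogeneous coordinates. -/
theorem eq_of_pointCoord_eq_smul {p q : OnePoint E3} {c : ℝ}
    (h : pointCoord p = c • pointCoord q) : p = q := by
  induction p using OnePoint.rec with
  | infty =>
    induction q using OnePoint.rec with
    | infty => rfl
    | coe q =>
      simp only [pointCoord_infty, pointCoord_coe, Prod.smul_mk, Prod.mk.injEq, smul_eq_mul,
        mul_one] at h
      obtain ⟨-, h2, h3, -⟩ := h
      simp [← h2] at h3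
  | coe p =>
    induction q using OnePoint.rec with
    | infty => simp [pointCoord_infty, pointCoord_coe] at h
    | coe q =>
      simp [pointCoord_coe] at h
      obtain ⟨h1, h2, -⟩ := h
      rw [h1, ← h2, one_smul]

/-- The plane through the point of a contact element which belongs to the contact element. -/
def ContactElement.tangentPlane (e : ContactElement) : LieSpace :=
  planeCoord e.normal
      (match e.point with
        | none => 0
        | some p => inner ℝ p e.normal)

theorem ContactElement.line_eq (e : ContactElement) :
    e.line = Submodule.span ℝ {pointCoord e.point, e.tangentPlane} := rfl

/-- The point has `e_r`-component zero and the plane has one, so the coefficient of the plane can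
only be `rComp S`. -/
theorem ContactElement.mem_line {e : ContactElement} {S : LieSpace} :
    S ∈ e.line ↔ ∃ c : ℝ, S = c • pointCoord e.point + rComp S • e.tangentPlane := by
  rw [e.line_eq, Submodule.mem_span_pair]
  constructor
  · rintro ⟨a, b, rfl⟩
    refine ⟨a, ?_⟩
    have : rComp e.tangentPlane = 1 := rfl
    rw [rComp_add, rComp_smul, rComp_smul, rComp_pointCoord, this]
    simp
  · rintro ⟨c, h⟩
    exact ⟨c, _, h.symm⟩

theorem ContactElement.tangentPlane_of_point {e : ContactElement} {x : E3}
    (h : e.point = (x : OnePoint E3)) :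
    e.tangentPlane = (e.normal, 0, 2 * inner ℝ x e.normal, 1) := by
  unfold ContactElement.tangentPlane
  rw [h]
  rfl

theorem ContactElement.lieForm_pointCoord_tangentPlane {e e' : ContactElement}
    (h : e.point = e'.point) : lieForm (pointCoord e.point) e'.tangentPlane = 0 := by
  unfold ContactElement.tangentPlane
  rw [h]
  rcases e'.point with _ | p
  · simp [pointCoord, planeCoord, lieForm, rComp]
  · simp [pointCoord, planeCoord, lieForm, rComp]

theorem ContactElement.lieForm_tangentPlane (e e' : ContactElement) :
    lieForm e.tangentPlane e'.tangentPlane = inner ℝ e.normal e'.normal - 1 := by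
  unfold ContactElement.tangentPlane
  simp [planeCoord, lieForm, rComp]

/-- The angle of two contact elements at a common point is the angle of any two spheres which
belong to them. -/
theorem ContactElement.lieForm_of_mem_line {e e' : ContactElement} (h : e.point = e'.point)
    {S S' : LieSpace} (hS : S ∈ e.line) (hS' : S' ∈ e'.line) :
    lieForm S S' = rComp S * rComp S' * (inner ℝ e.normal e'.normal - 1) := by
  obtain ⟨c, hc⟩ := mem_line.1 hS
  obtain ⟨c', hc'⟩ := mem_line.1 hS'
  rw [hc, hc']
  simp only [lieForm_add_left, lieForm_add_right, lieForm_smul_left, lieForm_smul_right,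
    rComp_add, rComp_smul]
  rw [lieForm_pointCoord_tangentPlane h, lieForm_tangentPlane, ← h, lieForm_pointCoord_self,
    lieForm_comm, h, lieForm_pointCoord_tangentPlane h.symm, rComp_pointCoord]
  have : ∀ e : ContactElement, rComp e.tangentPlane = 1 := fun _ => rfl
  rw [this, this]
  ring

theorem ContactElement.exists_smul_pointCoord {e : ContactElement} {S : LieSpace}
    (hS : S ∈ e.line) (hr : rComp S = 0) :
    ∃ c : ℝ, S = c • pointCoord e.point := by
  obtain ⟨c, hc⟩ := mem_line.1 hS
  exact ⟨c, by rw [hc, hr]; simp⟩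

/-- The isotropic line of a contact element is two-dimensional. -/
theorem ContactElement.not_line_le_span_singleton (e : ContactElement) (v : LieSpace) :
    ¬ e.line ≤ Submodule.span ℝ {v} := by
  intro h
  have h1 : pointCoord e.point ∈ Submodule.span ℝ {v} :=
    h (by rw [e.line_eq]; exact Submodule.subset_span (by simp))
  have h2 : e.tangentPlane ∈ Submodule.span ℝ {v} :=
    h (by rw [e.line_eq]; exact Submodule.subset_span (by simp))
  obtain ⟨a, ha⟩ := Submodule.mem_span_singleton.1 h1
  obtain ⟨b, hb⟩ := Submodule.mem_span_singleton.1 h2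
  have hb' : b * rComp v = 1 := by rw [← rComp_smul, hb]; rfl
  have ha' : a * rComp v = 0 := by rw [← rComp_smul, ha, rComp_pointCoord]
  have hv : rComp v ≠ 0 := by rintro h0; simp [h0] at hb'
  have : a = 0 := by simpa [hv] using ha'
  rw [this, zero_smul] at ha
  exact pointCoord_ne_zero _ ha.symm

/-- The normals of a sphere at two of its points are symmetric with respect to the bisecting
plane of the points. -/
theorem ContactElement.normal_eq_bisectorReflection {e e' : ContactElement} {x y : E3}
    (hx : e.point = (x : OnePoint E3)) (hy : e'.point = (y : OnePoint E3)) (hxy : x ≠ y)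
    {S : LieSpace} (hS : S ∈ e.line) (hS' : S ∈ e'.line) (hr : rComp S ≠ 0) :
    e'.normal = bisectorReflection x y e.normal := by
  obtain ⟨c, hc⟩ := mem_line.1 hS
  obtain ⟨c', hc'⟩ := mem_line.1 hS'
  rw [tangentPlane_of_point hx, hx, pointCoord_coe] at hc
  rw [tangentPlane_of_point hy, hy, pointCoord_coe] at hc'
  generalize rComp S = r at *
  have h := hc.symm.trans hc'
  simp only [Prod.smul_mk, Prod.mk_add_mk, Prod.mk.injEq, smul_eq_mul] at h
  obtain ⟨h1, h2, h3, -⟩ := h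
  -- `S` is decomposed at both points. The `e₀`-components give equal coefficients, the vector parts
  -- show that the normals differ by a multiple of `y - x`, and the `e_∞`-components fix that
  -- multiple.
  have hcc : c' = c := by linarith
  subst hcc
  have hd : 0 < inner ℝ (y - x) (y - x) := by
    rw [real_inner_self_eq_norm_sq]
    exact pow_pos (norm_pos_iff.2 (sub_ne_zero.2 hxy.symm)) 2
  have hn : r • e'.normal = r • e.normal - c' • (y - x) := by
    rw [eq_sub_of_add_eq' h1.symm]
    module
  have hin : r * inner ℝ y e'.normal = r * inner ℝ y e.normal - c' * inner ℝ y (y - x) := by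
    rw [← real_inner_smul_right, hn, inner_sub_right, real_inner_smul_right, real_inner_smul_right]
  have hc2 : c' * inner ℝ (y - x) (y - x) = 2 * r * inner ℝ (y - x) e.normal := by
    simp only [inner_sub_left, inner_sub_right, real_inner_self_eq_norm_sq,
      real_inner_comm x y] at *
    linear_combination h3 + 2 * hin
  have : r • e'.normal = r • bisectorReflection x y e.normal := by
    rw [hn, bisectorReflection, smul_sub r e.normal, smul_smul]
    congr 2
    field_simp
    linarith
  exact smul_right_injective _ hr this

/-! ## Circular arcs -/

/-- The derivative of the homogeneous coordinates of a point `x` in the direction `τ`. -/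
def tangentCoord (x τ : E3) : LieSpace := (τ, 0, 2 * inner ℝ x τ, 0)

theorem tangentCoord_smul (x τ : E3) (c : ℝ) : tangentCoord x (c • τ) = c • tangentCoord x τ := by
  simp only [tangentCoord, real_inner_smul_right, Prod.smul_mk, smul_eq_mul, mul_zero]
  congr 3; ring

theorem lieForm_tangentCoord_self (x τ : E3) :
    lieForm (tangentCoord x τ) (tangentCoord x τ) = ‖τ‖ ^ 2 := by
  simp [tangentCoord, lieForm, rComp]

theorem lieForm_tangentCoord_pointCoord (x τ y : E3) :
    lieForm (tangentCoord x τ) (pointCoord (y : OnePoint E3)) = inner ℝ (y - x) τ := by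
  simp [tangentCoord, pointCoord_coe, lieForm, rComp, inner_sub_left, real_inner_comm]

/-- Vectors without `e_r`-component orthogonal to a point are tangent vectors there. -/
theorem eq_tangentCoord_add {x : E3} {M : LieSpace} (hr : rComp M = 0)
    (hM : lieForm M (pointCoord (x : OnePoint E3)) = 0) :
    M = tangentCoord x (M.1 - M.2.1 • x) + M.2.1 • pointCoord (x : OnePoint E3) := by
  obtain ⟨v, k, l, r⟩ := M
  simp only [rComp] at hr
  subst hr
  simp only [lieForm, pointCoord_coe, rComp] at hM
  simp only [tangentCoord, pointCoord_coe, Prod.smul_mk, Prod.mk_add_mk, Prod.mk.injEq,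
    inner_sub_right, real_inner_smul_right, real_inner_self_eq_norm_sq, smul_eq_mul]
  refine ⟨by simp, by ring, ?_, by ring⟩
  rw [real_inner_comm v x]
  linarith

/-- The middle control vector of the arc from `x` to `y` with unit tangent vector `τ` at `x`. -/
def arcMid (x y τ : E3) : LieSpace :=
  ‖x - y‖ • (tangentCoord x τ - (lieForm (tangentCoord x τ) (pointCoord (y : OnePoint E3)) /
    lieForm (pointCoord (x : OnePoint E3)) (pointCoord (y : OnePoint E3))) •
      pointCoord (x : OnePoint E3))

/-- The closed circular arc from `x` to `y` with unit tangent vector `τ` at `x`. -/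
def arcSet (x y τ : E3) : Set (OnePoint E3) :=
  {p | ∃ s r c : ℝ, 0 ≤ s ∧ 0 ≤ r ∧ pointCoord p =
    c • (s ^ 2 • pointCoord (x : OnePoint E3) + (s * r) • arcMid x y τ +
      r ^ 2 • pointCoord (y : OnePoint E3))}

/-- Weight functions of a rational quadratic parametrization of an arc over `[0,1]`. -/
structure BlendWeights (σ ρ : ℝ → ℝ) : Prop where
  left_zero : σ 0 = 1
  right_zero : ρ 0 = 0
  left_one : σ 1 = 0
  right_one : ρ 1 = 1
  left_nonneg : ∀ v ∈ Icc (0 : ℝ) 1, 0 ≤ σ v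
  right_nonneg : ∀ v ∈ Icc (0 : ℝ) 1, 0 ≤ ρ v
  left_differentiable : Differentiable ℝ σ
  right_differentiable : Differentiable ℝ ρ
  right_deriv_pos : 0 < deriv ρ 0

/-- The rational quadratic curve with control vectors `A`, `M`, `C`. -/
def blend (A M C : LieSpace) (s r : ℝ) : LieSpace := s ^ 2 • A + (s * r) • M + r ^ 2 • C

/-- The points of `γ` form the conic with control vectors `A`, `M`, `C`, and its contact elements
belong to a common sphere which is not a point. -/
structure IsBlendArc (γ : ℝ → ContactElement) (A M C : LieSpace) (σ ρ : ℝ → ℝ) : Prop where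
  rComp_mid : rComp M = 0
  mid_left : lieForm M A = 0
  mid_right : lieForm M C = 0
  mid_self : lieForm M M = -2 * lieForm A C
  point : ∀ v ∈ Icc (0 : ℝ) 1, ∃ c : ℝ, c ≠ 0 ∧
    blend A M C (σ v) (ρ v) = c • pointCoord (γ v).point
  sphere : ∃ S, rComp S ≠ 0 ∧ ∀ v ∈ Icc (0 : ℝ) 1, S ∈ (γ v).line

section
variable {γ : ℝ → ContactElement} {A M C : LieSpace} {σ ρ : ℝ → ℝ} {x y τ : E3}

theorem IsBlendArc.exists_left (h : IsBlendArc γ A M C σ ρ) (hw : BlendWeights σ ρ)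
    (hx : (γ 0).point = (x : OnePoint E3)) : ∃ α : ℝ, α ≠ 0 ∧ A = α • pointCoord (x : OnePoint E3) := by
  obtain ⟨c, hc, h0⟩ := h.point 0 (by simp)
  rw [hw.left_zero, hw.right_zero, hx] at h0
  exact ⟨c, hc, by rw [← h0]; simp [blend]⟩

theorem IsBlendArc.exists_right (h : IsBlendArc γ A M C σ ρ) (hw : BlendWeights σ ρ)
    (hy : (γ 1).point = (y : OnePoint E3)) : ∃ α : ℝ, α ≠ 0 ∧ C = α • pointCoord (y : OnePoint E3) := by
  obtain ⟨c, hc, h0⟩ := h.point 1 (by simp)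
  rw [hw.left_one, hw.right_one, hy] at h0
  exact ⟨c, hc, by rw [← h0]; simp [blend]⟩

theorem norm_sub_sq_pos (hxy : x ≠ y) : 0 < ‖x - y‖ ^ 2 :=
  pow_pos (norm_pos_iff.2 (sub_ne_zero.2 hxy)) 2

/-- The initial tangent vector of a conic is determined by its middle control vector. -/
theorem IsBlendArc.exists_tangent (h : IsBlendArc γ A M C σ ρ) (hw : BlendWeights σ ρ)
    {α : ℝ} (hα : α ≠ 0) (hA : A = α • pointCoord (x : OnePoint E3))
    (ht : HasInitialTangent (fun v => (γ v).point) τ) :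
    ∃ c : ℝ, 0 < c ∧ M.1 - M.2.1 • x = (α * c) • τ := by
  obtain ⟨g, c, hc, hg, hd⟩ := ht
  have hσ := (hw.left_differentiable 0).hasDerivAt
  have hρ := (hw.right_differentiable 0).hasDerivAt
  set σ' := deriv σ 0
  set ρ' := deriv ρ 0
  have hρ' : 0 < ρ' := hw.right_deriv_pos
  set k : ℝ → ℝ := fun v => (blend A M C (σ v) (ρ v)).2.1 with hk
  set w : ℝ → E3 := fun v => (blend A M C (σ v) (ρ v)).1 with hwdef
  have hk' : HasDerivAt k (2 * σ' * A.2.1 + ρ' * M.2.1) 0 := by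
    have := (((hσ.pow 2).mul_const A.2.1).add ((hσ.mul hρ).mul_const M.2.1)).add
      ((hρ.pow 2).mul_const C.2.1)
    refine this.congr_deriv ?_
    simp [hw.left_zero, hw.right_zero]
  have hw' : HasDerivAt w ((2 * σ') • A.1 + ρ' • M.1) 0 := by
    have := (((hσ.pow 2).smul_const A.1).add ((hσ.mul hρ).smul_const M.1)).add
      ((hρ.pow 2).smul_const C.1)
    refine this.congr_deriv ?_
    simp [hw.left_zero, hw.right_zero]
  have hk0 : k 0 = α := by
    simp [hk, blend, hw.left_zero, hw.right_zero, hA, pointCoord_coe]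
  have hw0 : w 0 = α • x := by
    simp [hwdef, blend, hw.left_zero, hw.right_zero, hA, pointCoord_coe]
  have hev : ∀ᶠ v in 𝓝[≥] (0 : ℝ), g v = (k v)⁻¹ • w v := by
    have h1 : ∀ᶠ v in 𝓝[≥] (0 : ℝ), v ∈ Icc (0 : ℝ) 1 := Icc_mem_nhdsGE one_pos
    filter_upwards [hg, h1] with v hv hv1
    obtain ⟨b, hb, hbv⟩ := h.point v hv1
    rw [hv, pointCoord_coe] at hbv
    simp [hk, hwdef, hbv, smul_smul, hb]
  have hd2 : HasDerivWithinAt g ((k 0)⁻¹ • ((2 * σ') • A.1 + ρ' • M.1) +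
      (-(2 * σ' * A.2.1 + ρ' * M.2.1) / (k 0) ^ 2) • w 0) (Ici 0) 0 := by
    have := ((hk'.fun_inv (by rw [hk0]; exact hα)).smul hw').hasDerivWithinAt (s := Ici 0)
    exact this.congr_of_eventuallyEq hev (hev.self_of_nhdsWithin (by simp))
  have huniq := (uniqueDiffWithinAt_Ici (0 : ℝ)).eq_deriv _ hd hd2
  refine ⟨c / ρ', by positivity, ?_⟩
  rw [hk0, hw0, hA, pointCoord_coe] at huniq
  have h3 : (α * (c / ρ')) • τ = (α / ρ') • (c • τ) := by rw [smul_smul]; congr 1; ring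
  rw [h3, huniq]
  simp only [Prod.smul_fst, Prod.smul_snd, smul_eq_mul, mul_one, smul_add, smul_smul]
  match_scalars <;> field_simp
  ring

/-- A conic arc is determined by its end points and its initial direction. -/
theorem IsBlendArc.edgeArc_eq (h : IsBlendArc γ A M C σ ρ) (hw : BlendWeights σ ρ)
    (hy : (γ 1).point = (y : OnePoint E3)) (hxy : x ≠ y)
    (hτ : ‖τ‖ = 1) {α c : ℝ} (hα : α ≠ 0) (hA : A = α • pointCoord (x : OnePoint E3))
    (hc : 0 < c) (hM : M.1 - M.2.1 • x = (α * c) • τ) :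
    edgeArc γ = arcSet x y τ := by
  obtain ⟨β, hβ, hC⟩ := h.exists_right hw hy
  have hMx : lieForm M (pointCoord (x : OnePoint E3)) = 0 := by
    have := h.mid_left
    rw [hA, lieForm_smul_right] at this
    simpa [hα] using this
  have hMy : lieForm M (pointCoord (y : OnePoint E3)) = 0 := by
    have := h.mid_right
    rw [hC, lieForm_smul_right] at this
    simpa [hβ] using this
  have hMeq := eq_tangentCoord_add h.rComp_mid hMx
  rw [hM, tangentCoord_smul] at hMeq
  set k := M.2.1
  have hD := norm_sub_sq_pos hxy
  have hDn : 0 < ‖x - y‖ := norm_pos_iff.2 (sub_ne_zero.2 hxy)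
  have hself := h.mid_self
  have hcross : lieForm (tangentCoord x τ) (pointCoord (x : OnePoint E3)) = 0 := by
    rw [lieForm_tangentCoord_pointCoord]; simp
  have hXY := lieForm_pointCoord_coe x y
  -- The normalization `mid_self` ties the weight at `y` to the weight at `x` and the speed `c`, so
  -- up to the common factor `α` only one parameter is left. It is `κ` below, which merely rescales
  -- the second weight.
  have hβeq : β * ‖x - y‖ ^ 2 = α * c ^ 2 := by
    rw [hA, hC, hMeq] at hself
    simp only [lieForm_add_left, lieForm_add_right, lieForm_smul_left, lieForm_smul_right,
      lieForm_comm (pointCoord (x : OnePoint E3)) (tangentCoord x τ), hcross,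
      lieForm_pointCoord_self, lieForm_tangentCoord_self, hτ, hXY] at hself
    have : α * (β * ‖x - y‖ ^ 2) = α * (α * c ^ 2) := by linear_combination -hself
    exact mul_left_cancel₀ hα this
  set κ := c / ‖x - y‖ with hκ
  have hκ0 : 0 < κ := by positivity
  have hCκ : C = (α * κ ^ 2) • pointCoord (y : OnePoint E3) := by
    rw [hC]; congr 1; rw [hκ]; field_simp; linarith
  have hMκ : M = (α * κ) • arcMid x y τ := by
    rw [hMeq, lieForm_add_left, lieForm_smul_left, lieForm_smul_left] at hMy
    rw [hMeq, arcMid, smul_smul, smul_sub, smul_smul, sub_eq_add_neg, ← neg_smul]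
    have hXY0 : lieForm (pointCoord (x : OnePoint E3)) (pointCoord (y : OnePoint E3)) ≠ 0 := by
      rw [hXY]; linarith
    congr 2
    · rw [hκ]; field_simp
    · rw [hκ]; field_simp; linarith
  have hblend : ∀ s r, blend A M C s r = α • (s ^ 2 • pointCoord (x : OnePoint E3) +
      (s * (κ * r)) • arcMid x y τ + (κ * r) ^ 2 • pointCoord (y : OnePoint E3)) := by
    intro s r
    rw [blend, hA, hMκ, hCκ]
    module
  apply Subset.antisymm
  · rintro p ⟨v, hv, rfl⟩
    obtain ⟨b, hb, hbv⟩ := h.point v hv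
    refine ⟨σ v, κ * ρ v, b⁻¹ * α, hw.left_nonneg v hv,
      mul_nonneg hκ0.le (hw.right_nonneg v hv), ?_⟩
    rw [mul_smul, ← hblend, hbv, smul_smul, inv_mul_cancel₀ hb, one_smul]
  · rintro p ⟨s, r, b, hs, hr, hp⟩
    -- Only the ratio of the two weights matters for the point. The intermediate value theorem finds
    -- a parameter at which `σ` and `κ * ρ` are in the ratio `s : r`; the two weights cannot vanish
    -- together, since the blend is nonzero.
    have hcont : ContinuousOn (fun v => κ * ρ v * s - σ v * r) (Icc 0 1) :=
      (((hw.right_differentiable.continuous.const_mul κ).mul_const s).sub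
        (hw.left_differentiable.continuous.mul_const r)).continuousOn
    have hivt := intermediate_value_Icc (zero_le_one' ℝ) hcont
    obtain ⟨v, hv, hv0⟩ : (0 : ℝ) ∈ (fun v => κ * ρ v * s - σ v * r) '' Icc 0 1 := by
      apply hivt
      simp only [hw.left_zero, hw.right_zero, hw.left_one, hw.right_one]
      constructor
      · simpa using hr
      · have := mul_nonneg hκ0.le hs
        simpa using this
    refine ⟨v, hv, ?_⟩
    simp only at hv0
    obtain ⟨e, he, hev⟩ := h.point v hv
    have hprop : ∃ μ : ℝ, s = μ * σ v ∧ r = μ * (κ * ρ v) := by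
      by_cases hσ : σ v = 0
      · have hρ : ρ v ≠ 0 := by
          intro h0
          refine smul_ne_zero he (pointCoord_ne_zero (γ v).point) ?_
          rw [← hev, hσ, h0]
          simp [blend]
        refine ⟨r / (κ * ρ v), ?_, by field_simp⟩
        have : κ * ρ v * s = 0 := by rw [hσ] at hv0; linarith
        rw [hσ]
        simpa [hκ0.ne', hρ] using this
      · exact ⟨s / σ v, by field_simp, by field_simp; linarith⟩
    obtain ⟨μ, rfl, rfl⟩ := hprop
    have hpe : pointCoord p = (b * μ ^ 2 * α⁻¹ * e) • pointCoord (γ v).point := by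
      rw [mul_smul, ← hev, hblend, smul_smul, hp]
      rw [show b * μ ^ 2 * α⁻¹ * α = b * μ ^ 2 by field_simp]
      module
    exact (eq_of_pointCoord_eq_smul hpe).symm

end

/-! ## Embedded quadrilaterals -/

/-- The point `o` lies strictly between `0` and `b` and strictly between `c` and `d`. In the order
`0 < o < b < c` the factor `c - o` exceeds `b - o`, so equality of the products forces `o - d < o`.
The converse compares the same factors. -/
theorem separation_aux {o b c d : ℝ} (hc : 0 < c) (h0 : 0 < o * (b - o))
    (h : o * (b - o) = (c - o) * (o - d)) (hd : d ≠ 0) :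
    0 < b * (c - b) ↔ 0 < d * (c - d) := by
  have h1 : 0 < (c - o) * (o - d) := h ▸ h0
  constructor
  · intro hb
    have hb0 : 0 < b := by
      by_contra! hb'
      nlinarith
    have hcb : b < c := by nlinarith
    have ho : 0 < o ∧ o < b := by
      rcases pos_and_pos_or_neg_and_neg_of_mul_pos h0 with h | h
      · exact ⟨h.1, by linarith [h.2]⟩
      · linarith [h.1, h.2]
    have hod : d < o := by nlinarith
    have : 0 < d := by
      by_contra! hd'
      have hd'' : d < 0 := lt_of_le_of_ne hd' hd
      nlinarith
    exact mul_pos this (by linarith)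
  · intro hd'
    have hd0 : 0 < d := by
      by_contra! hb'
      nlinarith
    have hcd : d < c := by nlinarith
    have ho : d < o ∧ o < c := by
      rcases pos_and_pos_or_neg_and_neg_of_mul_pos h1 with h | h
      · exact ⟨by linarith [h.2], by linarith [h.1]⟩
      · linarith [h.1, h.2]
    have hob : o < b := by nlinarith
    have : b < c := by
      by_contra! hb'
      nlinarith
    exact mul_pos (by linarith) (by linarith)

/-- If a point of the line has the same negative power with respect to the pairs `{0, b}` and
`{c, d}`, then `{0, c}` does not separate `b` from `d`. -/
theorem separation_iff {o b c d : ℝ} (hc : c ≠ 0) (h0 : 0 < o * (b - o))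
    (h : o * (b - o) = (c - o) * (o - d)) (hd : d ≠ 0) :
    0 < b * (c - b) ↔ 0 < d * (c - d) := by
  rcases lt_or_gt_of_ne hc with hc | hc
  · have := separation_aux (o := -o) (b := -b) (c := -c) (d := -d) (by linarith) (by linarith)
      (by linarith) (by simpa using hd)
    rw [show -b * (-c - -b) = b * (c - b) by ring,
      show -d * (-c - -d) = d * (c - d) by ring] at this
    exact this
  · exact separation_aux hc h0 h hd

theorem sbtw_smul_add_iff {a v : E3} (hv : v ≠ 0) (r s : ℝ) :
    Sbtw ℝ a (r • v + a) (s • v + a) ↔ 0 < r * (s - r) := by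
  rw [sbtw_iff_mem_image_Ioo_and_ne]
  constructor
  · rintro ⟨⟨e, ⟨he0, he1⟩, he⟩, hne⟩
    rw [AffineMap.lineMap_apply] at he
    simp only [vsub_eq_sub, add_sub_cancel_right, vadd_eq_add, add_left_inj, smul_smul] at he
    have hr : e * s = r := smul_left_injective ℝ hv he
    have hs : s ≠ 0 := by rintro rfl; simp at hne
    have : 0 < s ^ 2 := by positivity
    rw [← hr, show e * s * (s - e * s) = e * (1 - e) * s ^ 2 by ring]
    have := sub_pos.2 he1
    positivity
  · intro h
    have hs : s ≠ 0 := by rintro rfl; nlinarith [sq_nonneg r]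
    have hs2 : 0 < s ^ 2 := by positivity
    refine ⟨⟨r / s, ⟨?_, ?_⟩, ?_⟩, ?_⟩
    · rw [show r / s = r * s / s ^ 2 by field_simp]
      exact div_pos (by nlinarith [sq_nonneg r]) hs2
    · rw [show r / s = r * s / s ^ 2 by field_simp, div_lt_one hs2]
      nlinarith [sq_nonneg (s - r)]
    · rw [AffineMap.lineMap_apply]
      simp [smul_smul, hs]
    · intro h
      have : s • v = 0 := by simpa using h.symm
      simp [hs, hv] at this

/-- In an embedded quadrilateral the point pairs of opposite edges do not separate each other. -/
theorem IsEmbeddedQuad.not_crossing {a b c d : E3} (h : IsEmbeddedQuad a b c d)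
    {s r s' r' : ℝ} (hsr : 0 < s * r) (hsr' : 0 < s' * r')
    (heq : s • pointCoord (a : OnePoint E3) + r • pointCoord (b : OnePoint E3) =
      s' • pointCoord (c : OnePoint E3) + r' • pointCoord (d : OnePoint E3)) : False := by
  simp only [pointCoord_coe, Prod.smul_mk, Prod.mk_add_mk, Prod.mk.injEq, smul_eq_mul, mul_one,
    mul_zero, add_zero, and_true] at heq
  obtain ⟨h1, h2, h3⟩ := heq
  -- Coefficients of equal sign have nonzero sum. Dividing by it turns both sides into proper convex
  -- combinations: the open segments meet in a point.
  have hk : s + r ≠ 0 := by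
    intro h0
    have : r = -s := by linarith
    subst this
    nlinarith [sq_nonneg s]
  obtain ⟨k, hkdef⟩ : ∃ k, k = s + r := ⟨_, rfl⟩
  have hk' : k = s' + r' := by rw [hkdef, h2]
  rw [← hkdef] at hk
  obtain ⟨p, rfl⟩ : ∃ p, r = k * p := ⟨r / k, by field_simp⟩
  obtain ⟨q, rfl⟩ : ∃ q, r' = k * q := ⟨r' / k, by field_simp⟩
  obtain rfl : s = k * (1 - p) := by linarith
  obtain rfl : s' = k * (1 - q) := by linarith
  have hk2 : 0 < k ^ 2 := by positivity
  have hp : 0 < (1 - p) * p := by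
    refine pos_of_mul_pos_right ?_ hk2.le
    linarith
  have hq : 0 < (1 - q) * q := by
    refine pos_of_mul_pos_right ?_ hk2.le
    linarith
  have hp' : 0 < p ∧ p < 1 := by constructor <;> nlinarith
  have hq' : 0 < q ∧ q < 1 := by constructor <;> nlinarith
  have h1' : (1 - p) • a + p • b = (1 - q) • c + q • d := by
    apply smul_right_injective _ hk
    simpa only [smul_add, smul_smul] using h1
  have h3' : (1 - p) * ‖a‖ ^ 2 + p * ‖b‖ ^ 2 = (1 - q) * ‖c‖ ^ 2 + q * ‖d‖ ^ 2 := by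
    apply mul_left_cancel₀ hk
    linarith
  obtain ⟨⟨hab, hac, had, hbc, hbd, hcd⟩, hE⟩ := h
  rcases hE with ⟨-, hdis, -⟩ | ⟨hcol, hx⟩
  · refine Set.disjoint_left.1 hdis (?_ : (1 - p) • a + p • b ∈ segment ℝ a b) ?_
    · exact ⟨1 - p, p, by linarith [hp'.2], hp'.1.le, by ring, rfl⟩
    · rw [h1']
      exact ⟨1 - q, q, by linarith [hq'.2], hq'.1.le, by ring, rfl⟩
  · rw [collinear_iff_of_mem (p₀ := a) (by simp)] at hcol
    obtain ⟨v, hv⟩ := hcol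
    obtain ⟨β, hβ⟩ := hv b (by simp)
    obtain ⟨γ, hγ⟩ := hv c (by simp)
    obtain ⟨δ, hδ⟩ := hv d (by simp)
    simp only [vadd_eq_add] at hβ hγ hδ
    subst hβ hγ hδ
    have hv0 : v ≠ 0 := by rintro rfl; simp at hab
    have hv2 : ‖v‖ ^ 2 ≠ 0 := by simpa using hv0
    have e1 : p * β = (1 - q) * γ + q * δ := by
      apply smul_left_injective ℝ hv0
      have : p • β • v = (1 - q) • γ • v + q • δ • v := by
        rw [← sub_eq_zero] at h1' ⊢
        rw [← h1']
        module
      simpa only [add_smul, smul_smul] using this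
    have e2 : p * β ^ 2 = (1 - q) * γ ^ 2 + q * δ ^ 2 := by
      simp only [norm_add_sq_real, norm_smul, real_inner_smul_left, mul_pow, Real.norm_eq_abs,
        sq_abs] at h3'
      apply mul_right_cancel₀ hv2
      linear_combination h3' - 2 * inner ℝ v a * e1
    have hβ0 : β ≠ 0 := by rintro rfl; simp at hab
    have hγ0 : γ ≠ 0 := by rintro rfl; simp at hac
    have hδ0 : δ ≠ 0 := by rintro rfl; simp at had
    have hβ2 : 0 < β ^ 2 := by positivity
    -- With `a` as origin of the line, `p * β` is the common point of the two segments. The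
    -- comparison of the squared norms says that its powers with respect to both pairs agree. Both
    -- sides of the exclusive or then become equivalent.
    have key := separation_iff (o := p * β) (b := β) (c := γ) (d := δ) hγ0
      (by rw [show p * β * (β - p * β) = (1 - p) * p * β ^ 2 by ring]; positivity)
      (by linear_combination e2 - (γ + δ) * e1) hδ0
    rw [sbtw_smul_add_iff hv0, sbtw_smul_add_iff hv0, key] at hx
    simp at hx

theorem IsEmbeddedQuad.reverse {a b c d : E3} (h : IsEmbeddedQuad a b c d) :
    IsEmbeddedQuad a d c b := by
  obtain ⟨⟨hab, hac, had, hbc, hbd, hcd⟩, hE⟩ := h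
  have hset : ({a, d, c, b} : Set E3) = {a, b, c, d} := by
    ext; simp only [mem_insert_iff, mem_singleton_iff]; tauto
  refine ⟨⟨had, hac, hab, hcd.symm, hbd.symm, hbc.symm⟩, ?_⟩
  rw [hset]
  rcases hE with ⟨h1, h2, h3⟩ | ⟨h1, h2⟩
  · left
    refine ⟨h1, ?_, ?_⟩
    · rw [segment_symm ℝ a d, segment_symm ℝ c b]; exact h3.symm
    · rw [segment_symm ℝ d c, segment_symm ℝ b a]; exact h2.symm
  · exact Or.inr ⟨h1, xor_comm _ _ ▸ h2⟩

/-! ## Opposite edges of a patch -/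

theorem bisectorReflection_smul (x y v : E3) (c : ℝ) :
    bisectorReflection x y (c • v) = c • bisectorReflection x y v := by
  simp only [bisectorReflection, real_inner_smul_right, smul_sub c v, smul_smul]
  rw [mul_div_assoc, mul_left_comm]

/-- The opposite edges `f 0` and `f 1` are conic arcs whose control vectors differ by multiples of
one vector. -/
structure IsBlendPair (f : PatchMap) (A M C m : LieSpace) (a μ c : ℝ) (σ ρ : ℝ → ℝ) : Prop where
  weights : BlendWeights σ ρ
  first : IsBlendArc (f 0) A M C σ ρ
  second : IsBlendArc (f 1) (A + a • m) (M + μ • m) (C + c • m) σ ρ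
  common : ∃ S, rComp S ≠ 0 ∧ S ∈ (f 0 0).line ∧ S ∈ (f 1 0).line

/-- `γ` is a circular arc from `x` to `y` with unit tangent `τ` at `x`, its contact elements
belong to a common sphere and the normal at `x` is `n`. -/
structure IsFrameArc (γ : ℝ → ContactElement) (x y τ n : E3) : Prop where
  arc : edgeArc γ = arcSet x y τ
  sphere : ∃ S, rComp S ≠ 0 ∧ ∀ v ∈ Icc (0 : ℝ) 1, S ∈ (γ v).line
  initial : (γ 0).point = (x : OnePoint E3)
  normal : (γ 0).normal = n

/-- `M` is orthogonal to the point `x` and has no `e_r`-component, so its square is that of a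
Euclidean vector and is nonnegative. By `mid_self` it is also a positive multiple of `α * β`. -/
theorem IsBlendArc.mul_pos {γ : ℝ → ContactElement} {A M C : LieSpace} {σ ρ : ℝ → ℝ} {x y : E3}
    (h : IsBlendArc γ A M C σ ρ) (hxy : x ≠ y) {α β : ℝ} (hα : α ≠ 0) (hβ : β ≠ 0)
    (hA : A = α • pointCoord (x : OnePoint E3)) (hC : C = β • pointCoord (y : OnePoint E3)) :
    0 < α * β := by
  have hMx : lieForm M (pointCoord (x : OnePoint E3)) = 0 := by
    have := h.mid_left
    rw [hA, lieForm_smul_right] at this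
    simpa [hα] using this
  have hself := h.mid_self
  rw [eq_tangentCoord_add h.rComp_mid hMx, hA, hC] at hself
  have hcross : ∀ τ, lieForm (tangentCoord x τ) (pointCoord (x : OnePoint E3)) = 0 := by
    intro τ; rw [lieForm_tangentCoord_pointCoord]; simp
  simp only [lieForm_add_left, lieForm_add_right, lieForm_smul_left, lieForm_smul_right,
    lieForm_comm (pointCoord (x : OnePoint E3)) (tangentCoord x _), hcross,
    lieForm_pointCoord_self, lieForm_tangentCoord_self, lieForm_pointCoord_coe] at hself
  have hD := norm_sub_sq_pos hxy
  have h1 : 0 ≤ α * β := by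
    by_contra! hneg
    nlinarith [sq_nonneg ‖M.1 - M.2.1 • x‖, mul_pos_of_neg_of_neg hneg (neg_neg_of_pos hD)]
  exact lt_of_le_of_ne h1 (mul_ne_zero hα hβ).symm

/-- Initial tangent vectors of opposite edges are symmetric with respect to the bisecting plane
of their initial points. -/
theorem tangent_eq_bisectorReflection {x y : E3} (hxy : x ≠ y) {A M m : LieSpace}
    {a μ α β : ℝ} (hα : α ≠ 0) (hβ : β ≠ 0) (hr : rComp M = 0) (hMA : lieForm M A = 0)
    (hMA' : lieForm (M + μ • m) (A + a • m) = 0)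
    (hA : A = α • pointCoord (x : OnePoint E3)) (hA' : A + a • m = β • pointCoord (y : OnePoint E3)) :
    (M + μ • m).1 - (M + μ • m).2.1 • y = bisectorReflection x y (M.1 - M.2.1 • x) := by
  have ha : a ≠ 0 := by
    rintro rfl
    rw [zero_smul, add_zero, hA] at hA'
    have : pointCoord (x : OnePoint E3) = (α⁻¹ * β) • pointCoord (y : OnePoint E3) := by
      rw [mul_smul, ← hA', smul_smul, inv_mul_cancel₀ hα, one_smul]
    exact hxy (OnePoint.coe_injective (eq_of_pointCoord_eq_smul this))
  -- Since `m` joins the two initial points, the new middle vector is the old tangent vector plus a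
  -- combination of these points. Orthogonality to `y` fixes the coefficient `κ` of `x`, which is
  -- the coefficient in the reflection.
  have hm : m = (a⁻¹ * β) • pointCoord (y : OnePoint E3) -
      (a⁻¹ * α) • pointCoord (x : OnePoint E3) := by
    rw [mul_smul, mul_smul, ← hA', ← hA, smul_add, smul_smul, inv_mul_cancel₀ ha, one_smul]
    abel
  have hMx : lieForm M (pointCoord (x : OnePoint E3)) = 0 := by
    rw [hA, lieForm_smul_right] at hMA
    simpa [hα] using hMA
  have hMy : lieForm (M + μ • m) (pointCoord (y : OnePoint E3)) = 0 := by
    rw [hA', lieForm_smul_right] at hMA'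
    simpa [hβ] using hMA'
  have hM := eq_tangentCoord_add hr hMx
  set w := M.1 - M.2.1 • x
  set κ := M.2.1 - μ * (a⁻¹ * α) with hκ
  have hM1 : M + μ • m = tangentCoord x w + κ • pointCoord (x : OnePoint E3) +
      (μ * (a⁻¹ * β)) • pointCoord (y : OnePoint E3) := by
    rw [hm, hκ]
    nth_rewrite 1 [hM]
    module
  rw [hM1] at hMy ⊢
  simp only [lieForm_add_left, lieForm_smul_left, lieForm_tangentCoord_pointCoord,
    lieForm_pointCoord_self, lieForm_pointCoord_coe] at hMy
  have hD := norm_sub_sq_pos hxy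
  have hκ2 : κ = 2 * (inner ℝ (y - x) w / inner ℝ (y - x) (y - x)) := by
    rw [real_inner_self_eq_norm_sq, norm_sub_rev]
    rw [← mul_div_assoc, eq_div_iff hD.ne']
    linarith
  rw [bisectorReflection, ← hκ2]
  simp only [tangentCoord, pointCoord_coe, Prod.smul_mk, Prod.mk_add_mk, smul_eq_mul]
  module

/-- A patch moves its own frame by reflection, as the net does. Reflection determines the new
tangent only up to sign; embeddedness of the quadrilateral decides the sign. -/
theorem IsBlendPair.isFrameArc {f : PatchMap} {A M C m : LieSpace} {a μ c : ℝ} {σ ρ : ℝ → ℝ}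
    (h : IsBlendPair f A M C m a μ c σ ρ) {x x₁ x₁₂ x₂ τ₁ τ₂ n : E3}
    (hf : HasVerticesAndFrame f x x₁ x₁₂ x₂ τ₁ τ₂ n) (hq : IsEmbeddedQuad x x₁ x₁₂ x₂)
    (hτ : ‖τ₂‖ = 1) (hτ' : ‖bisectorReflection x x₁ τ₂‖ = 1) :
    IsFrameArc (f 0) x x₂ τ₂ n ∧
      IsFrameArc (f 1) x₁ x₁₂ (bisectorReflection x x₁ τ₂) (bisectorReflection x x₁ n) := by
  have hw := h.weights
  obtain ⟨h01, -, h02, h112, -, h122⟩ := hq.1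
  obtain ⟨α, hα, hA⟩ := h.first.exists_left hw hf.vertex
  obtain ⟨γ, hγ, hC⟩ := h.first.exists_right hw hf.vertex₂
  obtain ⟨α', hα', hA'⟩ := h.second.exists_left hw hf.vertex₁
  obtain ⟨γ', hγ', hC'⟩ := h.second.exists_right hw hf.vertex₁₂
  obtain ⟨e, he, het⟩ := h.first.exists_tangent hw hα hA hf.tangent₂
  have hp := h.first.mul_pos h02 hα hγ hA hC
  have hp' := h.second.mul_pos h112 hα' hγ' hA' hC'
  -- `A' - A` and `C' - C` are multiples of `m`, which is a linear relation between the four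
  -- vertices. If `α` and `α'` had opposite signs, so would `γ` and `γ'`, and the relation would
  -- describe crossing opposite sides. The sign is what makes the speed `α * e / α'` positive below.
  have hαα : 0 < α * α' := by
    refine lt_of_le_of_ne ?_ (mul_ne_zero hα hα').symm
    by_contra! hneg
    have hneg2 : γ * γ' < 0 := by
      by_contra! h0
      nlinarith [mul_pos hp hp', mul_nonneg h0 (neg_nonneg.2 hneg.le)]
    have ham : a • m = α' • pointCoord (x₁ : OnePoint E3) - α • pointCoord (x : OnePoint E3) := by
      rw [← hA', ← hA]; abel
    have hcm : c • m = γ' • pointCoord (x₁₂ : OnePoint E3) - γ • pointCoord (x₂ : OnePoint E3) := by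
      rw [← hC', ← hC]; abel
    have hne : ∀ {u v : E3} {k l : ℝ}, u ≠ v → k ≠ 0 →
        l • pointCoord (u : OnePoint E3) - k • pointCoord (v : OnePoint E3) ≠ 0 := by
      intro u v k l huv hk h0
      have : pointCoord (v : OnePoint E3) = (k⁻¹ * l) • pointCoord (u : OnePoint E3) := by
        rw [mul_smul, sub_eq_zero.1 h0, smul_smul, inv_mul_cancel₀ hk, one_smul]
      exact huv (OnePoint.coe_injective (eq_of_pointCoord_eq_smul this)).symm
    have ha : a ≠ 0 := by
      rintro rfl
      exact hne h01.symm hα (by rw [← ham, zero_smul])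
    have hc : c ≠ 0 := by
      rintro rfl
      exact hne h122 hγ (by rw [← hcm, zero_smul])
    have ha2 : 0 < a ^ 2 := by positivity
    have hc2 : 0 < c ^ 2 := by positivity
    refine hq.not_crossing (s := c * -α) (r := c * α') (s' := a * γ') (r' := a * -γ)
      ?_ ?_ ?_
    · nlinarith
    · nlinarith
    · have : c • (a • m) = a • (c • m) := smul_comm _ _ _
      rw [ham, hcm] at this
      rw [← sub_eq_zero] at this ⊢
      rw [← this]
      module
  have htan := tangent_eq_bisectorReflection h01 hα hα' h.first.rComp_mid h.first.mid_left
    h.second.mid_left hA hA'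
  obtain ⟨S, hS, hS0, hS1⟩ := h.common
  refine ⟨⟨h.first.edgeArc_eq hw hf.vertex₂ h02 hτ hα hA he het, h.first.sphere, hf.vertex,
    hf.normal⟩, ⟨?_, h.second.sphere, hf.vertex₁, ?_⟩⟩
  · refine h.second.edgeArc_eq hw hf.vertex₁₂ h112 hτ' hα' hA' (c := α * e / α') ?_ ?_
    · rw [show α * e / α' = (α * α') * e / α' ^ 2 by field_simp]
      positivity
    · rw [htan, het, bisectorReflection_smul]
      congr 1
      field_simp
  · rw [← hf.normal]
    exact ContactElement.normal_eq_bisectorReflection hf.vertex hf.vertex₁ h01 hS0 hS1 hS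

/-! ## Edges of cyclidic patches -/

theorem span_pair_smul_add {k : ℝ} (hk : k ≠ 0) (l : ℝ) (w S : LieSpace) :
    Submodule.span ℝ {k • w + l • S, S} = Submodule.span ℝ {w, S} := by
  ext v
  simp only [Submodule.mem_span_pair]
  constructor
  · rintro ⟨s, r, rfl⟩
    exact ⟨s * k, s * l + r, by module⟩
  · rintro ⟨s, r, rfl⟩
    refine ⟨s * k⁻¹, r - s * k⁻¹ * l, ?_⟩
    rw [smul_add, smul_smul, mul_assoc, inv_mul_cancel₀ hk]
    module

/-- The only vectors of a contact element without `e_r`-component are multiples of its point. The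
blend is nonzero because it spans a two-dimensional line together with `S`. -/
theorem IsBlendArc.of_line {γ : ℝ → ContactElement} {A M C S : LieSpace} {σ ρ : ℝ → ℝ}
    (hA : rComp A = 0) (hM : rComp M = 0) (hC : rComp C = 0) (hMA : lieForm M A = 0)
    (hMC : lieForm M C = 0) (hMM : lieForm M M = -2 * lieForm A C) (hS : rComp S ≠ 0)
    (hline : ∀ v ∈ Icc (0 : ℝ) 1,
      (γ v).line = Submodule.span ℝ {blend A M C (σ v) (ρ v), S}) :
    IsBlendArc γ A M C σ ρ where
  rComp_mid := hM
  mid_left := hMA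
  mid_right := hMC
  mid_self := hMM
  point := by
    intro v hv
    have hmem : blend A M C (σ v) (ρ v) ∈ (γ v).line := by
      rw [hline v hv]; exact Submodule.subset_span (by simp)
    obtain ⟨c, hc⟩ := ContactElement.exists_smul_pointCoord hmem
      (by simp [blend, rComp_add, rComp_smul, hA, hM, hC])
    refine ⟨c, ?_, hc⟩
    rintro rfl
    apply (γ v).not_line_le_span_singleton S
    rw [hline v hv, hc, zero_smul]
    exact Submodule.span_le.2 (by simp [insert_subset_iff])
  sphere := ⟨S, hS, fun v hv => by rw [hline v hv]; exact Submodule.subset_span (by simp)⟩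

/-! ### Linear and trigonometric weight functions -/

theorem blendWeights_linear : BlendWeights (fun v => 1 - v) (fun v => v) where
  left_zero := by simp
  right_zero := rfl
  left_one := by simp
  right_one := rfl
  left_nonneg := fun v hv => by simpa using hv.2
  right_nonneg := fun v hv => hv.1
  left_differentiable := by fun_prop
  right_differentiable := by fun_prop
  right_deriv_pos := by simp

theorem sin_mul_div_sin_nonneg {d : ℝ} (hd : |d| < Real.pi) {v : ℝ} (hv : v ∈ Icc (0 : ℝ) 1) :
    0 ≤ Real.sin (v * d) / Real.sin d := by
  obtain ⟨h1, h2⟩ := abs_lt.1 hd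
  rcases le_total 0 d with h | h
  · exact div_nonneg
      (Real.sin_nonneg_of_nonneg_of_le_pi (mul_nonneg hv.1 h) (by nlinarith [hv.1, hv.2]))
      (Real.sin_nonneg_of_nonneg_of_le_pi h h2.le)
  · exact div_nonneg_of_nonpos
      (Real.sin_nonpos_of_nonpos_of_neg_pi_le (mul_nonpos_of_nonneg_of_nonpos hv.1 h)
        (by nlinarith [hv.1, hv.2]))
      (Real.sin_nonpos_of_nonpos_of_neg_pi_le h h1.le)

theorem div_sin_pos {d : ℝ} (hd : |d| < Real.pi) (hd0 : d ≠ 0) : 0 < d / Real.sin d := by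
  obtain ⟨h1, h2⟩ := abs_lt.1 hd
  rcases lt_or_gt_of_ne hd0 with h | h
  · exact div_pos_of_neg_of_neg h (Real.sin_neg_of_neg_of_neg_pi_lt h h1)
  · exact div_pos h (Real.sin_pos_of_pos_of_lt_pi h h2)

theorem blendWeights_sin {d : ℝ} (hd : |d| < Real.pi) (hd0 : d ≠ 0) :
    BlendWeights (fun v => Real.sin ((1 - v) * d) / Real.sin d)
      (fun v => Real.sin (v * d) / Real.sin d) := by
  have hpos := div_sin_pos hd hd0
  have hs : Real.sin d ≠ 0 := by intro h; simp [h] at hpos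
  refine ⟨by simp [hs], by simp, by simp, by simp [hs], fun v hv => ?_, fun v hv =>
    sin_mul_div_sin_nonneg hd hv, by fun_prop, by fun_prop, ?_⟩
  · exact sin_mul_div_sin_nonneg hd ⟨by linarith [hv.2], by linarith [hv.1]⟩
  · have h1 : HasDerivAt (fun v : ℝ => Real.sin (v * d) / Real.sin d) (d / Real.sin d) 0 := by
      have := (((hasDerivAt_id (0 : ℝ)).mul_const d).sin).div_const (Real.sin d)
      simpa using this
    rw [h1.deriv]
    exact hpos

/-! ### Patches of Dupin cyclides -/

/-- The contact elements of `f` join the spheres of two orthogonal conics, which contain no point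
spheres over `[0,1]`. -/
def IsConicPatch (f : PatchMap) (s s' : Fin 3 → LieSpace) : Prop :=
  (∀ k, lieForm (s k) (s k) = 0) ∧ (∀ k, lieForm (s' k) (s' k) = 0) ∧
    (∀ k l, lieForm (s k) (s' l) = 0) ∧
    (∀ u ∈ Icc (0 : ℝ) 1, rComp (conicParam s u) ≠ 0) ∧
    (∀ v ∈ Icc (0 : ℝ) 1, rComp (conicParam s' v) ≠ 0) ∧
    ∀ u ∈ Icc (0 : ℝ) 1, ∀ v ∈ Icc (0 : ℝ) 1,
      (f u v).line = Submodule.span ℝ {conicParam s u, conicParam s' v}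

theorem IsConicPatch.swap {f : PatchMap} {s s' : Fin 3 → LieSpace} (h : IsConicPatch f s s') :
    IsConicPatch (fun u v => f v u) s' s := by
  obtain ⟨h1, h2, h3, h4, h5, h6⟩ := h
  refine ⟨h2, h1, fun k l => by rw [lieForm_comm, h3], h5, h4, fun u hu v hv => ?_⟩
  rw [h6 v hv u hu, Set.pair_comm]

theorem conicParam_mem {P : Submodule ℝ LieSpace} {s : Fin 3 → LieSpace} (hs : ∀ k, s k ∈ P)
    (w : ℝ) : conicParam s w ∈ P :=
  P.add_mem (P.add_mem (P.smul_mem _ (hs 0)) (P.smul_mem _ (hs 1))) (P.smul_mem _ (hs 2))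

/-- A point sphere in the contact element must be its point, which would then be singular. -/
theorem rComp_ne_zero_of_not_singular {P P' : Submodule ℝ LieSpace} {e : ContactElement}
    {c c' : LieSpace} (hline : e.line = Submodule.span ℝ {c, c'}) (hc : c ∈ P ∨ c ∈ P')
    (hns : ¬ IsSingularPoint P P' e.point) : rComp c ≠ 0 := by
  intro hr
  obtain ⟨k, hk⟩ := ContactElement.exists_smul_pointCoord
    (by rw [hline]; exact Submodule.subset_span (by simp) : c ∈ e.line) hr
  have hk0 : k ≠ 0 := by
    rintro rfl
    apply e.not_line_le_span_singleton c'
    rw [hline, hk, zero_smul]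
    exact Submodule.span_le.2 (by simp [insert_subset_iff])
  have hp : pointCoord e.point = k⁻¹ • c := by
    rw [hk, smul_smul, inv_mul_cancel₀ hk0, one_smul]
  apply hns
  unfold IsSingularPoint
  rw [hp]
  exact hc.imp (P.smul_mem _) (P'.smul_mem _)

theorem IsNonsingularDupinPatch.exists_conicPatch {f : PatchMap}
    (h : IsNonsingularDupinPatch f) : ∃ s s', IsConicPatch f s s' := by
  obtain ⟨P, P', s, s', hD, hs, hs', hf⟩ := h
  refine ⟨s, s', hs.isotropic, hs'.isotropic,
    fun k l => (hD.polar _).1 (hs'.mem l) _ (hs.mem k), fun u hu => ?_, fun v hv => ?_,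
    fun u hu v hv => (hf u hu v hv).1⟩
  · obtain ⟨h1, h2⟩ := hf u hu 0 (by simp)
    exact rComp_ne_zero_of_not_singular h1 (Or.inl (conicParam_mem hs.mem u)) h2
  · obtain ⟨h1, h2⟩ := hf 0 (by simp) v hv
    rw [Set.pair_comm] at h1
    exact rComp_ne_zero_of_not_singular h1 (Or.inr (conicParam_mem hs'.mem v)) h2

/-- A conic of spheres touching a fixed sphere `S` touches it in the points of an arc. -/
theorem IsBlendArc.of_touching {γ : ℝ → ContactElement} {A M C S : LieSpace} {σ ρ : ℝ → ℝ}
    (hMA : lieForm M A = 0) (hMC : lieForm M C = 0) (hMM : lieForm M M = -2 * lieForm A C)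
    (hSA : lieForm S A = 0) (hSM : lieForm S M = 0) (hSC : lieForm S C = 0)
    (hSS : lieForm S S = 0) (hS : rComp S ≠ 0)
    (hline : ∀ v ∈ Icc (0 : ℝ) 1,
      (γ v).line = Submodule.span ℝ {blend A M C (σ v) (ρ v), S}) :
    IsBlendArc γ (A - (rComp A / rComp S) • S) (M - (rComp M / rComp S) • S)
      (C - (rComp C / rComp S) • S) σ ρ := by
  have hr : ∀ X, rComp (X - (rComp X / rComp S) • S) = 0 := by
    intro X
    rw [rComp_sub, rComp_smul]
    field_simp
    ring
  -- Subtracting multiples of `S` removes the `e_r`-components without changing products, as `S` is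
  -- isotropic and orthogonal to all control vectors.
  have hform : ∀ X Y : LieSpace, lieForm S X = 0 → lieForm S Y = 0 → ∀ k l : ℝ,
      lieForm (X - k • S) (Y - l • S) = lieForm X Y := by
    intro X Y hX hY k l
    simp only [lieForm_sub_left, lieForm_sub_right, lieForm_smul_left, lieForm_smul_right,
      lieForm_comm X S, hX, hY, hSS]
    ring
  refine IsBlendArc.of_line (S := S) (hr A) (hr M) (hr C) ?_ ?_ ?_ hS fun v hv => ?_
  · rw [hform _ _ hSM hSA, hMA]
  · rw [hform _ _ hSM hSC, hMC]
  · rw [hform _ _ hSM hSM, hform _ _ hSA hSC, hMM]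
  · rw [hline v hv, ← span_pair_smul_add one_ne_zero (-((σ v) ^ 2 * (rComp A / rComp S) +
      σ v * ρ v * (rComp M / rComp S) + (ρ v) ^ 2 * (rComp C / rComp S)))]
    congr 2
    simp only [blend]
    module

theorem IsConicPatch.exists_blendPair {f : PatchMap} {s s' : Fin 3 → LieSpace}
    (h : IsConicPatch f s s') : ∃ A M C m a μ c σ ρ, IsBlendPair f A M C m a μ c σ ρ := by
  obtain ⟨hs, hs', hcross, hr, hr', hline⟩ := h
  have hr0 := hr 0 (by simp)
  have hr1 := hr 1 (by simp)
  set S₀ := conicParam s 0 with hS0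
  set S₁ := conicParam s 1 with hS1
  set A := lieForm (s' 1) (s' 2) • s' 0 with hA
  set C := lieForm (s' 0) (s' 1) • s' 2 with hC
  set M := lieForm (s' 0) (s' 2) • s' 1 - A - C with hM
  -- Bernstein form: `2v² - 3v + 1 = (1 - v)² - v(1 - v)` and `2v² - v = v² - v(1 - v)`.
  have hconic : ∀ v, conicParam s' v = blend A M C (1 - v) v := by
    intro v
    simp only [conicParam, blend, hM, hA, hC]
    module
  have hMA : lieForm M A = 0 := by
    simp only [hM, hA, hC, lieForm_sub_left, lieForm_smul_left, lieForm_smul_right, hs',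
      lieForm_comm (s' 2) (s' 0), lieForm_comm (s' 1) (s' 0)]
    ring
  have hMC : lieForm M C = 0 := by
    simp only [hM, hA, hC, lieForm_sub_left, lieForm_smul_left, lieForm_smul_right, hs']
    ring
  have hMM : lieForm M M = -2 * lieForm A C := by
    simp only [hM, hA, hC, lieForm_sub_left, lieForm_sub_right, lieForm_smul_left,
      lieForm_smul_right, hs', lieForm_comm (s' 2) (s' 0), lieForm_comm (s' 1) (s' 0),
      lieForm_comm (s' 2) (s' 1)]
    ring
  have hSs : ∀ w k, lieForm (conicParam s w) (s' k) = 0 := by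
    intro w k
    simp [conicParam, lieForm_add_left, lieForm_smul_left, hcross]
  have hS00 : lieForm S₀ S₀ = 0 := by
    simp [hS0, conicParam, lieForm_smul_left, lieForm_smul_right, hs]
  have hS11 : lieForm S₁ S₁ = 0 := by
    have : S₁ = lieForm (s 0) (s 1) • s 2 := by
      simp only [hS1, conicParam]; module
    simp [this, lieForm_smul_left, lieForm_smul_right, hs]
  have hSA : ∀ w, lieForm (conicParam s w) A = 0 := fun w => by
    simp [hA, lieForm_smul_right, hSs]
  have hSC : ∀ w, lieForm (conicParam s w) C = 0 := fun w => by
    simp [hC, lieForm_smul_right, hSs]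
  have hSM : ∀ w, lieForm (conicParam s w) M = 0 := fun w => by
    simp [hM, lieForm_sub_right, lieForm_smul_right, hSs, hSA, hSC]
  have harc : ∀ u ∈ Icc (0 : ℝ) 1, ∀ v ∈ Icc (0 : ℝ) 1,
      (f u v).line = Submodule.span ℝ {blend A M C (1 - v) v, conicParam s u} := by
    intro u hu v hv
    rw [hline u hu v hv, hconic, Set.pair_comm]
  -- Projecting along `S₁` instead of `S₀` changes a vector by a multiple of one fixed vector. This
  -- is the vector `m` of the pair.
  have hshift : ∀ X, X - (rComp X / rComp S₁) • S₁ = X - (rComp X / rComp S₀) • S₀ +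
      rComp X • ((rComp S₀)⁻¹ • S₀ - (rComp S₁)⁻¹ • S₁) := by
    intro X
    rw [div_eq_mul_inv, div_eq_mul_inv]
    module
  refine ⟨A - (rComp A / rComp S₀) • S₀, M - (rComp M / rComp S₀) • S₀,
    C - (rComp C / rComp S₀) • S₀, (rComp S₀)⁻¹ • S₀ - (rComp S₁)⁻¹ • S₁, rComp A, rComp M,
    rComp C, fun v => 1 - v, fun v => v, blendWeights_linear, ?_, ?_, ?_⟩
  · exact IsBlendArc.of_touching hMA hMC hMM (hSA 0) (hSM 0) (hSC 0) hS00 hr0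
      (harc 0 (by simp))
  · rw [← hshift, ← hshift, ← hshift]
    exact IsBlendArc.of_touching hMA hMC hMM (hSA 1) (hSM 1) (hSC 1) hS11 hr1
      (harc 1 (by simp))
  · refine ⟨conicParam s' 0, hr' 0 (by simp), ?_, ?_⟩
    · rw [hline 0 (by simp) 0 (by simp)]; exact Submodule.subset_span (by simp)
    · rw [hline 1 (by simp) 0 (by simp)]; exact Submodule.subset_span (by simp)

/-! ### Spherical patches -/

/-- A linear combination of the vectors of a Möbius frame. -/
def frameVec (q₀ q a b : LieSpace) (k₀ k₁ k₂ k₃ : ℝ) : LieSpace :=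
  k₀ • q₀ + k₁ • a + k₂ • b + k₃ • q

theorem IsMoebiusFrame.lieForm_frameVec {q₀ q a b : LieSpace} (h : IsMoebiusFrame q₀ q a b)
    (k₀ k₁ k₂ k₃ l₀ l₁ l₂ l₃ : ℝ) :
    lieForm (frameVec q₀ q a b k₀ k₁ k₂ k₃) (frameVec q₀ q a b l₀ l₁ l₂ l₃) =
      k₁ * l₁ + k₂ * l₂ - (k₀ * l₃ + k₃ * l₀) / 2 := by
  obtain ⟨-, ⟨h1, h2, h3⟩, ⟨h4, h5, h6⟩, h7, h8, h9, h10⟩ := h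
  simp only [frameVec, lieForm_add_left, lieForm_add_right, lieForm_smul_left, lieForm_smul_right,
    lieForm_comm q q₀, lieForm_comm a q₀, lieForm_comm b q₀, lieForm_comm a q, lieForm_comm b q,
    lieForm_comm b a, h1, h2, h3, h4, h5, h6, h7, h8, h9, h10]
  ring

theorem IsMoebiusFrame.rComp_frameVec {q₀ q a b : LieSpace} (h : IsMoebiusFrame q₀ q a b)
    (k₀ k₁ k₂ k₃ : ℝ) : rComp (frameVec q₀ q a b k₀ k₁ k₂ k₃) = 0 := by
  obtain ⟨⟨h1, h2, h3, h4⟩, -⟩ := h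
  simp [frameVec, rComp_add, rComp_smul, h1, h2, h3, h4]

theorem IsMoebiusFrame.swap {q₀ q a b : LieSpace} (h : IsMoebiusFrame q₀ q a b) :
    IsMoebiusFrame q₀ q b a := by
  obtain ⟨⟨h1, h2, h3, h4⟩, h5, ⟨h6, h7, h8⟩, h9, h10, h11, h12⟩ := h
  exact ⟨⟨h1, h2, h4, h3⟩, h5, ⟨h7, h6, by rw [lieForm_comm, h8]⟩, h10, h9, h12, h11⟩

/-- Reduces the arc to identities between coordinates in the frame. The homogeneous factor `k` is
left free, as angular edges need a factor depending on the radius. -/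
theorem IsMoebiusFrame.isBlendArc {q₀ q a b S : LieSpace} (h : IsMoebiusFrame q₀ q a b)
    (hS : rComp S ≠ 0) {γ : ℝ → ContactElement} {σ ρ : ℝ → ℝ}
    {A₀ A₁ A₂ A₃ M₀ M₁ M₂ M₃ C₀ C₁ C₂ C₃ : ℝ}
    (hMA : M₁ * A₁ + M₂ * A₂ - (M₀ * A₃ + M₃ * A₀) / 2 = 0)
    (hMC : M₁ * C₁ + M₂ * C₂ - (M₀ * C₃ + M₃ * C₀) / 2 = 0)
    (hMM : M₁ * M₁ + M₂ * M₂ - (M₀ * M₃ + M₃ * M₀) / 2 =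
      -2 * (A₁ * C₁ + A₂ * C₂ - (A₀ * C₃ + A₃ * C₀) / 2))
    {y : ℝ → ℝ × ℝ} {k : ℝ} (hk : k ≠ 0)
    (hline : ∀ v ∈ Icc (0 : ℝ) 1, (γ v).line = Submodule.span ℝ
      {q₀ + (y v).1 • a + (y v).2 • b + ((y v).1 ^ 2 + (y v).2 ^ 2) • q, S})
    (h₀ : ∀ v, k = σ v ^ 2 * A₀ + σ v * ρ v * M₀ + ρ v ^ 2 * C₀)
    (h₁ : ∀ v, k * (y v).1 = σ v ^ 2 * A₁ + σ v * ρ v * M₁ + ρ v ^ 2 * C₁)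
    (h₂ : ∀ v, k * (y v).2 = σ v ^ 2 * A₂ + σ v * ρ v * M₂ + ρ v ^ 2 * C₂)
    (h₃ : ∀ v, k * ((y v).1 ^ 2 + (y v).2 ^ 2) =
      σ v ^ 2 * A₃ + σ v * ρ v * M₃ + ρ v ^ 2 * C₃) :
    IsBlendArc γ (frameVec q₀ q a b A₀ A₁ A₂ A₃) (frameVec q₀ q a b M₀ M₁ M₂ M₃)
      (frameVec q₀ q a b C₀ C₁ C₂ C₃) σ ρ := by
  refine IsBlendArc.of_line (S := S) (h.rComp_frameVec _ _ _ _) (h.rComp_frameVec _ _ _ _)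
    (h.rComp_frameVec _ _ _ _) ?_ ?_ ?_ hS fun v hv => ?_
  · rw [h.lieForm_frameVec, hMA]
  · rw [h.lieForm_frameVec, hMC]
  · rw [h.lieForm_frameVec, h.lieForm_frameVec, hMM]
  · rw [hline v hv, ← span_pair_smul_add hk 0]
    congr 2
    have : blend (frameVec q₀ q a b A₀ A₁ A₂ A₃) (frameVec q₀ q a b M₀ M₁ M₂ M₃)
        (frameVec q₀ q a b C₀ C₁ C₂ C₃) (σ v) (ρ v) = k • q₀ + (k * (y v).1) • a +
          (k * (y v).2) • b + (k * ((y v).1 ^ 2 + (y v).2 ^ 2)) • q := by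
      rw [h₁, h₂, h₃]
      nth_rewrite 1 [h₀ v]
      simp only [blend, frameVec]
      module
    rw [this]
    module

/-- With the sine version below, this writes a unit vector as a combination of two others at angles
`-q` and `p` from it. -/
theorem sin_mul_cos_add (p q ψ : ℝ) :
    Real.sin p * Real.cos (ψ - q) + Real.sin q * Real.cos (ψ + p) =
      Real.sin (p + q) * Real.cos ψ := by
  rw [Real.cos_sub, Real.cos_add, Real.sin_add]; ring

theorem sin_mul_sin_add (p q ψ : ℝ) :
    Real.sin p * Real.sin (ψ - q) + Real.sin q * Real.sin (ψ + p) =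
      Real.sin (p + q) * Real.sin ψ := by
  rw [Real.sin_sub, Real.sin_add, Real.sin_add]; ring

/-- The rational quadratic parametrization of an arc of the unit circle by the angle. -/
theorem sin_blend {d : ℝ} (hd : Real.sin d ≠ 0) (μ v : ℝ) :
    (1 : ℝ) = (Real.sin ((1 - v) * d) / Real.sin d) ^ 2 +
      (Real.sin ((1 - v) * d) / Real.sin d) * (Real.sin (v * d) / Real.sin d) * (2 * Real.cos d) +
      (Real.sin (v * d) / Real.sin d) ^ 2 ∧
    Real.cos ((1 - v) * (μ - d) + v * (μ + d)) =
      (Real.sin ((1 - v) * d) / Real.sin d) ^ 2 * Real.cos (μ - d) +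
      (Real.sin ((1 - v) * d) / Real.sin d) * (Real.sin (v * d) / Real.sin d) *
        (2 * Real.cos μ) +
      (Real.sin (v * d) / Real.sin d) ^ 2 * Real.cos (μ + d) ∧
    Real.sin ((1 - v) * (μ - d) + v * (μ + d)) =
      (Real.sin ((1 - v) * d) / Real.sin d) ^ 2 * Real.sin (μ - d) +
      (Real.sin ((1 - v) * d) / Real.sin d) * (Real.sin (v * d) / Real.sin d) *
        (2 * Real.sin μ) +
      (Real.sin (v * d) / Real.sin d) ^ 2 * Real.sin (μ + d) := by
  -- At half the angle the unit vector is a linear combination of the two end vectors with weights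
  -- `σ`, `ρ`. Its complex square gives the last two identities, its squared norm the first.
  obtain ⟨ψ, hψ⟩ : ∃ ψ, (1 - v) * (μ - d) + v * (μ + d) = 2 * ψ :=
    ⟨_, (mul_div_cancel₀ _ two_ne_zero).symm⟩
  obtain ⟨p, hp⟩ : ∃ p, (1 - v) * d = p := ⟨_, rfl⟩
  obtain ⟨q, hq⟩ : ∃ q, v * d = q := ⟨_, rfl⟩
  have hpq : d = p + q := by rw [← hp, ← hq]; ring
  have hc := sin_mul_cos_add p q ψ
  have hs := sin_mul_sin_add p q ψ
  rw [← hpq] at hc hs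
  have e0 : μ - d = 2 * (ψ - q) := by rw [← hq]; linarith
  have e1 : μ + d = 2 * (ψ + p) := by rw [← hp]; linarith
  have e2 : μ = (ψ - q) + (ψ + p) := by linarith
  have e3 : d = (ψ + p) - (ψ - q) := by linarith
  have hμc : Real.cos μ = _ := e2 ▸ Real.cos_add (ψ - q) (ψ + p)
  have hμs : Real.sin μ = _ := e2 ▸ Real.sin_add (ψ - q) (ψ + p)
  have hdc : Real.cos d = _ := e3 ▸ Real.cos_sub (ψ + p) (ψ - q)
  have p0 := Real.sin_sq_add_cos_sq (ψ - q)
  have p1 := Real.sin_sq_add_cos_sq (ψ + p)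
  have p2 := Real.sin_sq_add_cos_sq ψ
  rw [hψ, hp, hq, e0, e1, hμc, hμs, hdc, Real.cos_two_mul', Real.cos_two_mul', Real.cos_two_mul',
    Real.sin_two_mul, Real.sin_two_mul, Real.sin_two_mul]
  generalize Real.sin (ψ - q) = s0 at *
  generalize Real.cos (ψ - q) = c0 at *
  generalize Real.sin (ψ + p) = s1 at *
  generalize Real.cos (ψ + p) = c1 at *
  generalize Real.sin ψ = s at *
  generalize Real.cos ψ = c at *
  generalize Real.sin d = D at *
  generalize Real.sin p = P at *
  generalize Real.sin q = Q at *
  have hc' : c = P / D * c0 + Q / D * c1 := by field_simp; linarith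
  have hs' : s = P / D * s0 + Q / D * s1 := by field_simp; linarith
  generalize P / D = σ at *
  generalize Q / D = ρ at *
  subst hc' hs'
  refine ⟨?_, by ring, by ring⟩
  linear_combination -p2 + σ ^ 2 * p0 + ρ ^ 2 * p1

/-- The contact elements of `f` belong to `S`, and their points are given by the coordinates `y`
with respect to a Möbius frame. -/
def IsFramePatch (f : PatchMap) (S q₀ q a b : LieSpace) (y : ℝ → ℝ → ℝ × ℝ) : Prop :=
  rComp S ≠ 0 ∧ IsMoebiusFrame q₀ q a b ∧
    ∀ u ∈ Icc (0 : ℝ) 1, ∀ v ∈ Icc (0 : ℝ) 1,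
      (f u v).line = Submodule.span ℝ
        {q₀ + (y u v).1 • a + (y u v).2 • b + ((y u v).1 ^ 2 + (y u v).2 ^ 2) • q, S}

section
variable {f : PatchMap} {S q₀ q a b : LieSpace} {y : ℝ → ℝ → ℝ × ℝ}

theorem IsFramePatch.swap (h : IsFramePatch f S q₀ q a b y) :
    IsFramePatch (fun u v => f v u) S q₀ q a b (fun u v => y v u) :=
  ⟨h.1, h.2.1, fun u hu v hv => h.2.2 v hv u hu⟩

theorem IsFramePatch.reflect (h : IsFramePatch f S q₀ q a b y) :
    IsFramePatch f S q₀ q b a (fun u v => (y u v).swap) := by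
  refine ⟨h.1, h.2.1.swap, fun u hu v hv => ?_⟩
  rw [h.2.2 u hu v hv]
  simp only [Prod.fst_swap, Prod.snd_swap]
  congr 2
  module

theorem IsFramePatch.common (h : IsFramePatch f S q₀ q a b y) :
    ∃ S, rComp S ≠ 0 ∧ S ∈ (f 0 0).line ∧ S ∈ (f 1 0).line := by
  refine ⟨S, h.1, ?_, ?_⟩
  · rw [h.2.2 0 (by simp) 0 (by simp)]; exact Submodule.subset_span (by simp)
  · rw [h.2.2 1 (by simp) 0 (by simp)]; exact Submodule.subset_span (by simp)

theorem IsFramePatch.exists_blendPair_cartesian (h : IsFramePatch f S q₀ q a b y)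
    (hy : IsCartesianRectangle y) : ∃ A M C m α μ c σ ρ, IsBlendPair f A M C m α μ c σ ρ := by
  obtain ⟨a₀, a₁, b₀, b₁, -, -, hy⟩ := hy
  have harc : ∀ u ∈ Icc (0 : ℝ) 1, ∀ e, (1 - u) * a₀ + u * a₁ = e →
      IsBlendArc (f u) (frameVec q₀ q a b 1 e b₀ (e ^ 2 + b₀ ^ 2))
        (frameVec q₀ q a b 2 (2 * e) (b₀ + b₁) (2 * (e ^ 2 + b₀ * b₁)))
        (frameVec q₀ q a b 1 e b₁ (e ^ 2 + b₁ ^ 2)) (fun v => 1 - v) (fun v => v) := by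
    intro u hu e he
    refine h.2.1.isBlendArc h.1 (by ring) (by ring) (by ring) one_ne_zero (h.2.2 u hu) ?_ ?_ ?_ ?_
      <;> intro v <;> (try rw [hy, he]) <;> ring
  -- Only `e` changes between opposite edges; it enters the control vectors with the factors `1`,
  -- `2`, `1`.
  refine ⟨_, _, _, frameVec q₀ q a b 0 (a₁ - a₀) 0 (a₁ ^ 2 - a₀ ^ 2), 1, 2, 1, _, _,
    blendWeights_linear, harc 0 (by simp) a₀ (by ring), ?_, h.common⟩
  convert harc 1 (by simp) a₁ (by ring) using 1 <;> simp only [frameVec] <;> module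

theorem IsFramePatch.exists_blendPair_radial (h : IsFramePatch f S q₀ q a b y)
    (hy : IsPolarRectangle fun u v => y v u) :
    ∃ A M C m α μ c σ ρ, IsBlendPair f A M C m α μ c σ ρ := by
  obtain ⟨r₀, r₁, θ₀, θ₁, -, -, -, -, -, hy⟩ := hy
  beta_reduce at hy
  have harc : ∀ u ∈ Icc (0 : ℝ) 1, ∀ θ, (1 - u) * θ₀ + u * θ₁ = θ →
      IsBlendArc (f u)
        (frameVec q₀ q a b 1 (r₀ * Real.cos θ) (r₀ * Real.sin θ) (r₀ ^ 2))
        (frameVec q₀ q a b 2 ((r₀ + r₁) * Real.cos θ) ((r₀ + r₁) * Real.sin θ) (2 * r₀ * r₁))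
        (frameVec q₀ q a b 1 (r₁ * Real.cos θ) (r₁ * Real.sin θ) (r₁ ^ 2))
        (fun v => 1 - v) (fun v => v) := by
    intro u hu θ hθ
    have hp := Real.sin_sq_add_cos_sq θ
    refine h.2.1.isBlendArc h.1 ?_ ?_ ?_ one_ne_zero (h.2.2 u hu) ?_ ?_ ?_ ?_
    · linear_combination ((r₀ + r₁) * r₀) * hp
    · linear_combination ((r₀ + r₁) * r₁) * hp
    · linear_combination ((r₀ + r₁) ^ 2 + 2 * r₀ * r₁) * hp
    · intro v; ring
    · intro v; rw [hy, hθ]; ring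
    · intro v; rw [hy, hθ]; ring
    · intro v
      rw [hy, hθ]
      linear_combination (((1 - v) * r₀ + v * r₁) ^ 2) * hp
  refine ⟨_, _, _, frameVec q₀ q a b 0 (Real.cos θ₁ - Real.cos θ₀) (Real.sin θ₁ - Real.sin θ₀) 0,
    r₀, r₀ + r₁, r₁, _, _, blendWeights_linear, harc 0 (by simp) θ₀ (by ring), ?_, h.common⟩
  convert harc 1 (by simp) θ₁ (by ring) using 1 <;> simp only [frameVec] <;> module

theorem IsFramePatch.exists_blendPair_angular (h : IsFramePatch f S q₀ q a b y)
    (hy : IsPolarRectangle y) : ∃ A M C m α μ c σ ρ, IsBlendPair f A M C m α μ c σ ρ := by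
  obtain ⟨r₀, r₁, θ₀, θ₁, hr₀, hr₁, -, hθ, hlt, hy⟩ := hy
  obtain ⟨d, hd⟩ : ∃ d, d = (θ₁ - θ₀) / 2 := ⟨_, rfl⟩
  obtain ⟨φ, hφ⟩ : ∃ φ, φ = (θ₀ + θ₁) / 2 := ⟨_, rfl⟩
  obtain rfl : θ₀ = φ - d := by rw [hd, hφ]; ring
  obtain rfl : θ₁ = φ + d := by linarith
  have hd0 : d ≠ 0 := by rintro rfl; simp at hθ
  have hdlt : |d| < Real.pi := by
    rw [show φ + d - (φ - d) = 2 * d by ring, abs_mul, abs_two] at hlt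
    linarith
  have hs : Real.sin d ≠ 0 := by
    have := div_sin_pos hdlt hd0
    intro h; simp [h] at this
  have hφp := Real.sin_sq_add_cos_sq φ
  have hdp := Real.sin_sq_add_cos_sq d
  -- The coordinates are divided by the radius, so that the components along `a` and `b` do not
  -- depend on `r` and arcs of different radii differ only along one combination of `q₀` and `q`.
  -- The half-angle `d` satisfies `|d| < π` because the angular length is below `2π`.
  have harc : ∀ u ∈ Icc (0 : ℝ) 1, ∀ r, (1 - u) * r₀ + u * r₁ = r → 0 < r →
      IsBlendArc (f u)
        (frameVec q₀ q a b r⁻¹ (Real.cos (φ - d)) (Real.sin (φ - d)) r)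
        (frameVec q₀ q a b (r⁻¹ * (2 * Real.cos d)) (2 * Real.cos φ) (2 * Real.sin φ)
          (r * (2 * Real.cos d)))
        (frameVec q₀ q a b r⁻¹ (Real.cos (φ + d)) (Real.sin (φ + d)) r)
        (fun v => Real.sin ((1 - v) * d) / Real.sin d) (fun v => Real.sin (v * d) / Real.sin d) := by
    intro u hu r hr hr0
    have hrr : r⁻¹ * r = 1 := inv_mul_cancel₀ hr0.ne'
    refine h.2.1.isBlendArc h.1 ?_ ?_ ?_ (inv_ne_zero hr0.ne') (h.2.2 u hu) ?_ ?_ ?_ ?_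
    · rw [Real.cos_sub, Real.sin_sub]
      linear_combination (2 * Real.cos d) * hφp - (2 * Real.cos d) * hrr
    · rw [Real.cos_add, Real.sin_add]
      linear_combination (2 * Real.cos d) * hφp - (2 * Real.cos d) * hrr
    · rw [Real.cos_sub, Real.sin_sub, Real.cos_add, Real.sin_add]
      linear_combination (4 + 2 * (Real.cos d ^ 2 - Real.sin d ^ 2)) * hφp -
        (4 * Real.cos d ^ 2 + 2) * hrr - 2 * hdp
    · intro v
      linear_combination r⁻¹ * (sin_blend hs φ v).1
    · intro v
      rw [hy, hr, ← (sin_blend hs φ v).2.1, ← mul_assoc, hrr, one_mul]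
    · intro v
      rw [hy, hr, ← (sin_blend hs φ v).2.2, ← mul_assoc, hrr, one_mul]
    · intro v
      rw [hy, hr]
      linear_combination r * (sin_blend hs φ v).1 + r * hrr +
        r⁻¹ * r ^ 2 * Real.sin_sq_add_cos_sq ((1 - v) * (φ - d) + v * (φ + d))
  refine ⟨_, _, _, frameVec q₀ q a b (r₁⁻¹ - r₀⁻¹) 0 0 (r₁ - r₀), 1, 2 * Real.cos d, 1, _, _,
    blendWeights_sin hdlt hd0, harc 0 (by simp) r₀ (by ring) hr₀, ?_, h.common⟩
  convert harc 1 (by simp) r₁ (by ring) hr₁ using 1 <;> simp only [frameVec] <;> module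

theorem IsFramePatch.exists_blendPair (h : IsFramePatch f S q₀ q a b y)
    (hy : IsCartesianRectangle y ∨ IsPolarRectangle y ∨ IsPolarRectangle (fun u v => y v u)) :
    ∃ A M C m α μ c σ ρ, IsBlendPair f A M C m α μ c σ ρ := by
  rcases hy with hy | hy | hy
  · exact h.exists_blendPair_cartesian hy
  · exact h.exists_blendPair_angular hy
  · exact h.exists_blendPair_radial hy

end

/-! ### Cyclidic patches in both parameter directions -/

theorem IsNonsingularCyclidicPatch.exists_blendPair {f : PatchMap}
    (h : IsNonsingularCyclidicPatch f) :
    ∃ A M C m a μ c σ ρ, IsBlendPair f A M C m a μ c σ ρ := by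
  rcases h with h | ⟨S, q₀, q, a, b, y, -, hS, hF, -, -, -, -, hy, hf⟩
  · obtain ⟨s, s', h⟩ := h.exists_conicPatch
    exact h.exists_blendPair
  · exact IsFramePatch.exists_blendPair ⟨hS, hF, hf⟩ hy

/-- Exchanging the parameters exchanges the two sphere families, or the radial and angular cases. A
Cartesian rectangle keeps its form once `a` and `b` are exchanged as well. -/
theorem IsNonsingularCyclidicPatch.exists_blendPair_swap {f : PatchMap}
    (h : IsNonsingularCyclidicPatch f) :
    ∃ A M C m a μ c σ ρ, IsBlendPair (fun u v => f v u) A M C m a μ c σ ρ := by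
  rcases h with h | ⟨S, q₀, q, a, b, y, -, hS, hF, -, -, -, -, hy, hf⟩
  · obtain ⟨s, s', h⟩ := h.exists_conicPatch
    exact h.swap.exists_blendPair
  · have hP : IsFramePatch f S q₀ q a b y := ⟨hS, hF, hf⟩
    rcases hy with ⟨a₀, a₁, b₀, b₁, ha, hb, hy⟩ | hy | hy
    · refine hP.swap.reflect.exists_blendPair_cartesian ⟨b₀, b₁, a₀, a₁, hb, ha, fun u v => ?_⟩
      simp [hy]
    · exact hP.swap.exists_blendPair_radial hy
    · exact hP.swap.exists_blendPair_angular hy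

/-! ## Faces of a cyclidic cube -/

theorem HasVerticesAndFrame.swap {f : PatchMap} {x x₁ x₁₂ x₂ τ₁ τ₂ n : E3}
    (h : HasVerticesAndFrame f x x₁ x₁₂ x₂ τ₁ τ₂ n) :
    HasVerticesAndFrame (fun u v => f v u) x x₂ x₁₂ x₁ τ₂ τ₁ n :=
  ⟨h.vertex, h.vertex₂, h.vertex₁₂, h.vertex₁, h.tangent₂, h.tangent₁, h.normal⟩

section
variable {x : (Fin 3 → ℤ) → E3} {t : (Fin 3 → ℤ) → Fin 3 → E3}

theorem IsCyclidicNet.embedded_of_ne (h : IsCyclidicNet x t) (z : Fin 3 → ℤ) {i j : Fin 3}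
    (hij : i ≠ j) : IsEmbeddedQuad (x z) (x (z + unitShift i))
      (x (z + unitShift i + unitShift j)) (x (z + unitShift j)) := by
  rcases lt_or_gt_of_ne hij with hlt | hlt
  · exact h.embedded z i j hlt
  · rw [add_right_comm]
    exact (h.embedded z j i hlt).reverse

theorem IsCyclidicNet.frame_shift (h : IsCyclidicNet x t) (z : Fin 3 → ℤ) {j k : Fin 3}
    (hkj : k ≠ j) : t (z + unitShift j) k =
      bisectorReflection (x z) (x (z + unitShift j)) (t z k) := by
  rw [h.evolution z j k, if_neg hkj]

/-- Let `f 0`, `f 1` be opposite conic edges of a face over the directions `j`, `k`. They are arcs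
determined by the frames of the net at their initial points. -/
theorem IsCyclidicNet.isFrameArc_of_blendPair (h : IsCyclidicNet x t) {w : Fin 3 → ℤ}
    {i j k : Fin 3} (hjk : j ≠ k) (hij : i ≠ j) {f : PatchMap}
    (hp : ∃ A M C m a μ c σ ρ, IsBlendPair f A M C m a μ c σ ρ)
    (hf : HasVerticesAndFrame f (x w) (x (w + unitShift j)) (x (w + unitShift j + unitShift k))
      (x (w + unitShift k)) (t w j) (t w k) (t w i)) (δ : Fin 2) :
    let v := w + ((δ : ℕ) : ℤ) • unitShift j
    IsFrameArc (f ((δ : ℕ) : ℝ)) (x v) (x (v + unitShift k)) (t v k) (t v i) := by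
  obtain ⟨A, M, C, m, a, μ, c, σ, ρ, hp⟩ := hp
  have key := hp.isFrameArc hf (h.embedded_of_ne w hjk) ((h.orthonormal w).1 k)
    (by rw [← h.frame_shift w hjk.symm]; exact (h.orthonormal _).1 k)
  rw [← h.frame_shift w hjk.symm, ← h.frame_shift w hij] at key
  fin_cases δ
  · simpa using key.1
  · simpa using key.2

theorem AreCubeFaces.isFrameArc (hnet : IsCyclidicNet x t) {z : Fin 3 → ℤ}
    {f : Fin 3 → Fin 2 → PatchMap} (hf : AreCubeFaces x t z f) {i j k : Fin 3} (hij : i ≠ j)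
    (hik : i ≠ k) (hjk : j ≠ k) (ε δ : Fin 2) :
    let v := z + ((ε : ℕ) : ℤ) • unitShift i + ((δ : ℕ) : ℤ) • unitShift j
    IsFrameArc (faceEdge (f i ε) i j δ) (x v) (x (v + unitShift k)) (t v k) (t v i) := by
  -- The parameters of a face run along `i + 1` and `i + 2` in this order; if the fixed direction is
  -- `i + 2`, the patch is transposed.
  have hcases : (j = i + 1 ∧ k = i + 2) ∨ (j ≠ i + 1 ∧ j = i + 2 ∧ k = i + 1) := by
    clear hf
    revert i j k
    decide
  obtain ⟨hp, hv⟩ := hf i ε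
  rcases hcases with ⟨hj, hk⟩ | ⟨hj, hj', hk⟩
  · rw [faceEdge, if_pos hj]
    subst hj hk
    exact hnet.isFrameArc_of_blendPair hjk hij hp.exists_blendPair hv δ
  · rw [faceEdge, if_neg hj]
    subst hj' hk
    have hv' := hv.swap
    rw [add_right_comm _ (unitShift (i + 1))] at hv'
    exact hnet.isFrameArc_of_blendPair hjk hij hp.exists_blendPair_swap hv' δ

end

end

/-! ### Constancy of the angle along a common edge -/

theorem mainTheorem6 (x : (Fin 3 → ℤ) → E3) (t : (Fin 3 → ℤ) → Fin 3 → E3)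
    (hnet : IsCyclidicNet x t) (z : Fin 3 → ℤ) (f : Fin 3 → Fin 2 → PatchMap)
    (hf : AreCubeFaces x t z f) (i j : Fin 3) (hij : i ≠ j) (ε δ : Fin 2) :
    edgeArc (faceEdge (f i ε) i j δ) = edgeArc (faceEdge (f j δ) j i ε) ∧
      ∀ a ∈ Icc (0 : ℝ) 1, ∀ b ∈ Icc (0 : ℝ) 1,
        (faceEdge (f i ε) i j δ a).point = (faceEdge (f j δ) j i ε b).point →
          (faceEdge (f i ε) i j δ a).IsOrthogonal (faceEdge (f j δ) j i ε b) := by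
  obtain ⟨k, hik, hjk⟩ : ∃ k, i ≠ k ∧ j ≠ k := by revert i j; decide
  have h1 := hf.isFrameArc hnet hij hik hjk ε δ
  have h2 := hf.isFrameArc hnet hij.symm hjk hik δ ε
  -- Both faces now refer to the same initial vertex, so their arcs are given by the same two end
  -- points and the same frame vector `t v k`.
  rw [add_right_comm z] at h2
  refine ⟨h1.arc.trans h2.arc.symm, fun a ha b hb hab => ⟨hab, ?_⟩⟩
  obtain ⟨S, hS, hS1⟩ := h1.sphere
  obtain ⟨S', hS', hS2⟩ := h2.sphere
  have e0 := ContactElement.lieForm_of_mem_line (h1.initial.trans h2.initial.symm)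
    (hS1 0 (by simp)) (hS2 0 (by simp))
  have e1 := ContactElement.lieForm_of_mem_line hab (hS1 a ha) (hS2 b hb)
  rw [h1.normal, h2.normal, (hnet.orthonormal _).2 hij] at e0
  -- The product of `S` and `S'` is evaluated at the initial vertex, where the normals are
  -- orthogonal, and at the given common point.
  have := mul_left_cancel₀ (mul_ne_zero hS hS') (e0.symm.trans e1)
  linarith
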